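/- Fix $1\le d<\infty$ and write $E=\mathbb C^d$. Let $X=\{X_k\}_{k\ge1}$ be an admissible sequence: $X_k\in B(E^{\otimes k})$, $X_k\ge 0$, $X_1$ is invertible and $\limsup_k\|X_k\|^{1/k}<\infty$. Write $x_{\alpha,\beta}$ ($|\alpha|=|\beta|=k$) for the matrix entries of $X_k$ with respect to the standard basis $e_\alpha=e_{\alpha(1)}\otimes\cdots\otimes e_{\alpha(k)}$, indexed by the words $\alpha$ of length $k$ in $\{1,\dots,d\}$. Put $R_0=I$ and, for $k\ge1$, $$R_k=\Big(\sum_{l=1}^k\ \sum_{a_1+\cdots+a_l=k,\ a_j\ge1}X_{a_1}\otimes\cdots\otimes X_{a_l}\Big)^{1/2},\qquad Z_k=R_k^{-1}(I_E\otimes R_{k-1}).$$ For $z\in\mathbb C^d$, or for a tuple of operators, write $z_\alpha=z_{\alpha(1)}\cdots z_{\alpha(k)}$, and for $w\in\mathbb C^d$ let $w^{(k)*}=\sum_{|\alpha|=k}\overline{w_\alpha}\,e_\alpha\in E^{\otimes k}$. Let $$D(X,\mathbb C)=\Big\{z\in\mathbb C^d:\ \sum_{k\ge1}\ \sum_{|\alpha|=|\beta|=k}x_{\alpha,\beta}\,z_\alpha\overline{z_\beta}\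 \text{ converges and is }<1\Big\}.$$ For a positive (semi)definite kernel $K$ on a set, $E_K$ denotes its reproducing kernel Hilbert space, with kernel functions $k_w=K(\cdot,w)$; $\otimes$ of Hilbert spaces is the Hilbert space tensor product, and elements of $E_K\otimes G$ are viewed as $G$-valued functions. "Subspace" means closed subspace. A partially isometric multiplier $\Theta\in\mathcal M(E_{K_1}\otimes\mathcal D,E_{K_2}\otimes G)$ is a function $\Theta$ with values in $B(\mathcal D,G)$ such that $\Theta f\in E_{K_2}\otimes G$ for every $f\in E_{K_1}\otimes\mathcal D$ and such that $M_\Theta:f\mapsto\Theta f$ is a partial isometry. Let $K^R_c(z,w)=\sum_{k\ge0}\sum_{|\alpha|=|\beta|=k}z_\alpha (R_k^2)_{\alpha,\beta}\overline{w_\beta}$, a positive kernel on $D(X,\mathbb C)$, and let $$\mathcal F(\mathcal R)=\bigoplus_{k\ge0}R_k\big(E^{\circledS k}\big)\subseteq\bigoplus_{k\ge0}E^{\otimes k},$$ where $E^{\circledS k}$ is the symmetric tensor power. For each $i$, the weighted shift $\tilde W_i\theta=Z_{k+1}(e_i\otimes\theta)$ ($\theta\in E^{\otimes k}$) is bounded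 on the full Fock space $\bigoplus_k E^{\otimes k}$; let $W_i=P_{\mathcal F(\mathcal R)}\tilde W_i|_{\mathcal F(\mathcal R)}$. There is a unitary $u:E_{K^R_c}\to\mathcal F(\mathcal R)$ with $u(k_w)=\bigoplus_k R_kw^{(k)*}$ for all $w\in D(X,\mathbb C)$; through $u$ the elements of $\mathcal F(\mathcal R)$ are viewed as functions on $D(X,\mathbb C)$, and multiplication by the coordinate function $z_i$ is then the operator $W_i$, i.e. $M_{z_i}=W_i$ on $\mathcal F(\mathcal R)$. **Theorem.** Let $G$ be a Hilbert space. Suppose that $K:D(X,\mathbb C)\times D(X,\mathbb C)\to\mathbb C$ is a positive (semi)definite kernel such that the coordinate functions $z_1,\dots,z_d$ are multipliers of $E_K$, with bounded multiplication operators $M_{z_i}$ satisfying $$\sum_{k\ge1}\ \sum_{|\alpha|=|\beta|=k}x_{\alpha,\beta}\,M_{z_\alpha}M_{z_\beta}^*\le I$$ (the sum over $k$ being weakly convergent). Then for every closed subspace $\mathcal S\subseteq E_K\otimes G$: 1. $\mathcal S$ is invariant under $M_{z_i}\otimes I_G$ for all $i$ if and only if there are a Hilbert space $\mathcal D$ and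 a partial isometry $\Pi:\mathcal F(\mathcal R)\otimes\mathcal D\to E_K\otimes G$ with $(M_{z_i}\otimes I_G)\Pi=\Pi(W_i\otimes I_{\mathcal D})$ for every $i$ and $\mathcal S=\Pi(\mathcal F(\mathcal R)\otimes\mathcal D)$. 2. $\mathcal S$ is invariant under $M_{z_i}\otimes I_G$ for all $i$ if and only if there are a Hilbert space $\mathcal D$ and a partially isometric multiplier $\Theta\in\mathcal M(E_{K^R_c}\otimes\mathcal D,E_K\otimes G)$ with $\mathcal S=M_\Theta(E_{K^R_c}\otimes\mathcal D)$. Moreover, for $K=K^R_c$ (with no further assumption): 3. A closed subspace $\mathcal S\subseteq\mathcal F(\mathcal R)\otimes G$ is invariant under $M_{z_i}\otimes I_G$ for all $i$ if and only if there are a Hilbert space $\mathcal D$ and a partially isometric multiplier $\Theta\in\mathcal M(\mathcal F(\mathcal R)\otimes\mathcal D,\mathcal F(\mathcal R)\otimes G)$ with $\mathcal S=M_\Theta(\mathcal F(\mathcal R)\otimes\mathcal D)$. -/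

import Mathlib

open scoped MatrixOrder ComplexOrder TensorProduct InnerProductSpace

universe u

noncomputable section

/-! ### Hilbert space tensor products -/

/-- The Hilbert space tensor product of `E` and `F`: the completion of the algebraic one. -/
def HTensor (E F : Type*) [NormedAddCommGroup E] [InnerProductSpace ℂ E]
    [NormedAddCommGroup F] [InnerProductSpace ℂ F] : Type _ :=
  UniformSpace.Completion (E ⊗[ℂ] F)

namespace HTensor

variable {E E' F : Type*} [NormedAddCommGroup E] [InnerProductSpace ℂ E]
  [NormedAddCommGroup E'] [InnerProductSpace ℂ E']
  [NormedAddCommGroup F] [InnerProductSpace ℂ F]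

instance : NormedAddCommGroup (HTensor E F) :=
  inferInstanceAs (NormedAddCommGroup (UniformSpace.Completion (E ⊗[ℂ] F)))

instance : InnerProductSpace ℂ (HTensor E F) :=
  inferInstanceAs (InnerProductSpace ℂ (UniformSpace.Completion (E ⊗[ℂ] F)))

instance : CompleteSpace (HTensor E F) :=
  inferInstanceAs (CompleteSpace (UniformSpace.Completion (E ⊗[ℂ] F)))

variable (E F) in
/-- The inclusion of the algebraic tensor product. -/
def incl : (E ⊗[ℂ] F) →ₗᵢ[ℂ] HTensor E F :=
  UniformSpace.Completion.toComplₗᵢ (𝕜 := ℂ) (E := E ⊗[ℂ] F)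

theorem denseRange_incl : DenseRange (incl E F) :=
  UniformSpace.Completion.denseRange_coe

/-- `A ⊗ I_F`, for a bounded operator `A`. -/
def ampliation (A : E →L[ℂ] E') (F : Type*) [NormedAddCommGroup F] [InnerProductSpace ℂ F] :
    HTensor E F →L[ℂ] HTensor E' F :=
  ((incl E' F).toContinuousLinearMap ∘L A.rTensor F).extend (incl E F).toContinuousLinearMap

/-- The bounded map `E ⊗ F → F` with `x ⊗ y ↦ φ x • y`, for a bounded functional `φ` on `E`. When
`E` is a space of functions and `φ` is the evaluation at a point `z`, this is the evaluation at `z`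
of the elements of `E ⊗ F`, viewed as `F`-valued functions. -/
def slice (φ : E →L[ℂ] ℂ) (F : Type*) [NormedAddCommGroup F] [InnerProductSpace ℂ F]
    [CompleteSpace F] : HTensor E F →L[ℂ] F :=
  (((TensorProduct.lidIsometry ℂ F).toContinuousLinearEquiv : (ℂ ⊗[ℂ] F) →L[ℂ] F) ∘L
    φ.rTensor F).extend (incl E F).toContinuousLinearMap

theorem ampliation_incl (A : E →L[ℂ] E') (x : E ⊗[ℂ] F) :
    ampliation A F (incl E F x) = incl E' F (A.rTensor F x) :=
  ContinuousLinearMap.extend_eq _ (e := (incl E F).toContinuousLinearMap)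
    denseRange_incl (incl E F).isometry.isUniformInducing x

theorem slice_tmul [CompleteSpace F] (φ : E →L[ℂ] ℂ) (x : E) (y : F) :
    slice φ F (incl E F (x ⊗ₜ[ℂ] y)) = φ x • y := by
  have := ContinuousLinearMap.extend_eq
    (((TensorProduct.lidIsometry ℂ F).toContinuousLinearEquiv : (ℂ ⊗[ℂ] F) →L[ℂ] F) ∘L
      φ.rTensor F) (e := (incl E F).toContinuousLinearMap)
    denseRange_incl (incl E F).isometry.isUniformInducing (x ⊗ₜ[ℂ] y)
  simpa [slice] using this

end HTensor

/-- A partial isometry: isometric on the orthogonal complement of its kernel. -/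
def IsPartialIsometry {E F : Type*} [NormedAddCommGroup E] [InnerProductSpace ℂ E]
    [NormedAddCommGroup F] [InnerProductSpace ℂ F] (V : E →L[ℂ] F) : Prop :=
  ∀ x ∈ (LinearMap.ker (V : E →ₗ[ℂ] F))ᗮ, ‖V x‖ = ‖x‖

/-- The compression `P_S A|_S`. -/
def compression {E : Type*} [NormedAddCommGroup E] [InnerProductSpace ℂ E]
    (S : Submodule ℂ E) [S.HasOrthogonalProjection] (A : E →L[ℂ] E) : S →L[ℂ] S :=
  S.orthogonalProjectionOnto ∘L A ∘L S.subtypeL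

/-! ### Scalar kernels, their reproducing kernel Hilbert spaces, and multipliers -/

/-- A positive definite kernel `K : Ω × Ω → ℂ`: all matrices `(K(zᵢ, zⱼ))` are positive
semidefinite. -/
structure PDKernel (Ω : Type*) where
  toFun : Ω → Ω → ℂ
  posSemidef : (Matrix.of toFun).PosSemidef

namespace PDKernel

variable {Ω : Type*}

/-- The kernel, with its scalar values viewed as operators on the Hilbert space `ℂ`. -/
def op (K : PDKernel Ω) : Matrix Ω Ω (ℂ →L[ℂ] ℂ) :=
  Matrix.of fun z w => K.toFun z w • ContinuousLinearMap.id ℂ ℂ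

theorem op_posSemidef (K : PDKernel Ω) : K.op.PosSemidef := by
  have key := (RKHS.posSemidef_tfae (K := K.op)).out 0 2
  rw [key]
  refine ⟨?_, fun v => ?_⟩
  · ext z w
    have h : star (K.toFun w z) = K.toFun z w := K.posSemidef.1.apply z w
    rw [Matrix.conjTranspose_apply]
    have h1 : star (ContinuousLinearMap.id ℂ ℂ) = ContinuousLinearMap.id ℂ ℂ :=
      star_one (ℂ →L[ℂ] ℂ)
    simp only [op, Matrix.of_apply, star_smul, h, h1]
  · have h := K.posSemidef.2 v
    rw [Finsupp.sum_comm] at h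
    refine le_of_le_of_eq (Complex.le_def.1 h).1 ?_
    rw [← Complex.conj_re]
    simp only [Finsupp.sum, map_sum, RCLike.re_to_complex, Complex.re_sum]
    refine Finset.sum_congr rfl fun z _ => Finset.sum_congr rfl fun w _ => ?_
    congr 1
    simp [op]
    ring

instance (K : PDKernel Ω) : Fact K.op.PosSemidef := ⟨K.op_posSemidef⟩

/-- The reproducing kernel Hilbert space `E_K`, a Hilbert space of functions `Ω → ℂ`. -/
def Space (K : PDKernel Ω) : Type _ := RKHS.OfKernel K.op

instance (K : PDKernel Ω) : NormedAddCommGroup K.Space :=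
  inferInstanceAs (NormedAddCommGroup (RKHS.OfKernel K.op))

instance (K : PDKernel Ω) : InnerProductSpace ℂ K.Space :=
  inferInstanceAs (InnerProductSpace ℂ (RKHS.OfKernel K.op))

instance (K : PDKernel Ω) : CompleteSpace K.Space :=
  inferInstanceAs (CompleteSpace (RKHS.OfKernel K.op))

instance (K : PDKernel Ω) : RKHS ℂ K.Space Ω ℂ :=
  inferInstanceAs (RKHS ℂ (RKHS.OfKernel K.op) Ω ℂ)

theorem kernel_space (K : PDKernel Ω) : RKHS.kernel K.Space = K.op :=
  RKHS.OfKernel.kernel_ofKernel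

/-- The evaluation functional `f ↦ f z` on `E_K`. -/
def eval (K : PDKernel Ω) (z : Ω) : K.Space →L[ℂ] ℂ :=
  (ContinuousLinearMap.proj z : (Ω → ℂ) →L[ℂ] ℂ) ∘L RKHS.coeCLM ℂ

/-- The kernel function `k_w = K(·, w)`, as an element of `E_K`. -/
def kernelFun (K : PDKernel Ω) (w : Ω) : K.Space := RKHS.kerFun K.Space w 1

theorem kernelFun_apply (K : PDKernel Ω) (w z : Ω) : K.kernelFun w z = K.toFun z w := by
  rw [kernelFun, RKHS.kerFun_apply, kernel_space]
  simp [op]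

theorem inner_kernelFun (K : PDKernel Ω) (w : Ω) (f : K.Space) : ⟪K.kernelFun w, f⟫_ℂ = f w := by
  simp [kernelFun]

end PDKernel

/-- `M` is the operator `M_Θ : f ↦ Θ f` from `H₁ ⊗ G₁` to `H₂ ⊗ G₂`. Here `H₁` and `H₂` are spaces
of scalar functions on `Ω`, given with their evaluation functionals `e₁ z` and `e₂ z`, and the
elements of `Hᵢ ⊗ Gᵢ` are viewed as `Gᵢ`-valued functions on `Ω`. In particular `Θ f` lies in
`H₂ ⊗ G₂` for every `f` in `H₁ ⊗ G₁`, that is, `Θ` is a multiplier. -/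
def IsMultiplicationOp {Ω H₁ H₂ G₁ G₂ : Type*}
    [NormedAddCommGroup H₁] [InnerProductSpace ℂ H₁] [NormedAddCommGroup H₂] [InnerProductSpace ℂ H₂]
    [NormedAddCommGroup G₁] [InnerProductSpace ℂ G₁] [CompleteSpace G₁]
    [NormedAddCommGroup G₂] [InnerProductSpace ℂ G₂] [CompleteSpace G₂]
    (e₁ : Ω → H₁ →L[ℂ] ℂ) (e₂ : Ω → H₂ →L[ℂ] ℂ) (Θ : Ω → G₁ →L[ℂ] G₂)
    (M : HTensor H₁ G₁ →L[ℂ] HTensor H₂ G₂) : Prop :=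
  ∀ f z, HTensor.slice (e₂ z) G₂ (M f) = Θ z (HTensor.slice (e₁ z) G₁ f)

/-! ### Admissible sequences

Words of length `k` in the letters `0, …, d - 1` are the functions `Fin k → Fin d`. The `k`-th
tensor power of `ℂ^d` is `EuclideanSpace ℂ (Fin k → Fin d)`, where the standard basis vector of a
word `α` is `e_{α(1)} ⊗ ⋯ ⊗ e_{α(k)}`, and operators on it are matrices indexed by words. -/

/-- An admissible sequence `X₁, X₂, …` with `X_k` acting on the `k`-th tensor power of `ℂ^d`
(the value `mat 0` is not used). -/
structure AdmissibleSeq (d : ℕ) where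
  mat : ∀ k : ℕ, Matrix (Fin k → Fin d) (Fin k → Fin d) ℂ
  posSemidef : ∀ k, 1 ≤ k → (mat k).PosSemidef
  isUnit_one : IsUnit (mat 1)
  limsup_lt_top : Filter.limsup
    (fun k : ℕ => ‖Matrix.toEuclideanCLM (n := Fin k → Fin d) (𝕜 := ℂ) (mat k)‖ₑ ^ (1 / (k : ℝ)))
    Filter.atTop < ⊤

theorem summable_prod_composition {p : ℕ → ℝ} (hp : ∀ k, 0 ≤ p k)
    (hs : Summable fun k => p (k + 1)) (hlt : ∑' k, p (k + 1) < 1) :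
    Summable fun k : ℕ => ∑ c : Composition k, ∏ j, p (c.blocksFun j) := by
  set s := ∑' k, p (k + 1) with hsdef
  have hs0 : 0 ≤ s := tsum_nonneg fun k => hp _
  refine summable_of_sum_range_le (c := (1 - s)⁻¹)
    (fun k => Finset.sum_nonneg fun c _ => Finset.prod_nonneg fun j _ => hp _) fun N => ?_
  calc ∑ k ∈ Finset.range N, ∑ c : Composition k, ∏ j, p (c.blocksFun j)
      ≤ ∑ d ∈ FormalMultilinearSeries.compPartialSumTarget 0 (N + 1) (N + 1),
          ∏ j : Fin d.2.length, p (d.2.blocksFun j) := by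
        rw [Finset.sum_sigma']
        refine Finset.sum_le_sum_of_subset_of_nonneg ?_
          fun _ _ _ => Finset.prod_nonneg fun j _ => hp _
        rintro ⟨k, c⟩ hd
        simp only [Finset.mem_sigma, Finset.mem_range, Finset.mem_univ, and_true] at hd
        rw [FormalMultilinearSeries.mem_compPartialSumTarget_iff]
        refine ⟨Nat.zero_le _, ?_, fun j => ?_⟩
        · have := c.length_le
          simp only; omega
        · have := c.blocksFun_le j
          simp only; omega
    _ = ∑ e ∈ FormalMultilinearSeries.compPartialSumSource 0 (N + 1) (N + 1),
          ∏ j : Fin e.1, p (e.2 j) := by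
        symm
        apply FormalMultilinearSeries.compChangeOfVariables_sum
        rintro ⟨k, blocksFun⟩ H
        have K : (FormalMultilinearSeries.compChangeOfVariables 0 (N + 1) (N + 1)
          ⟨k, blocksFun⟩ H).snd.length = k := by simp
        congr 2 <;> try rw [K]
        rw [Fin.heq_fun_iff K.symm]
        intro j
        rw [FormalMultilinearSeries.compChangeOfVariables_blocksFun]
    _ = ∑ l ∈ Finset.range (N + 1), (∑ k ∈ Finset.Ico 1 (N + 1), p k) ^ l := by
        rw [FormalMultilinearSeries.compPartialSumSource, ← Finset.sum_sigma' (Finset.Ico 0 (N + 1))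
          (fun l : ℕ => (Fintype.piFinset fun _ : Fin l => Finset.Ico 1 (N + 1) : Finset (Fin l → ℕ)))
          (fun l e => ∏ j : Fin l, p (e j))]
        rw [Nat.Ico_zero_eq_range]
        refine Finset.sum_congr rfl fun l _ => ?_
        rw [Finset.sum_prod_piFinset]
        simp
    _ ≤ ∑ l ∈ Finset.range (N + 1), s ^ l := by
        refine Finset.sum_le_sum fun l _ => pow_le_pow_left₀
          (Finset.sum_nonneg fun k _ => hp _) ?_ _
        rw [Finset.sum_Ico_eq_sum_range]
        simp only [Nat.add_sub_cancel, Nat.add_comm 1]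
        exact hs.sum_le_tsum _ fun k _ => hp _
    _ ≤ (1 - s)⁻¹ := by
        rw [← tsum_geometric_of_lt_one hs0 hlt]
        exact (summable_geometric_of_lt_one hs0 hlt).sum_le_tsum _ fun k _ => pow_nonneg hs0 _

theorem norm_le_of_posSemidef {Ω : Type*} {M : Matrix Ω Ω ℂ} (hM : M.PosSemidef) (z w : Ω) :
    ‖M z w‖ ≤ ((M z z).re + (M w w).re) / 2 := by
  have h := (hM.submatrix ![z, w]).det_nonneg
  have h1 := hM.diag_nonneg (i := z)
  have h2 := hM.diag_nonneg (i := w)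
  have h3 : M w z = star (M z w) := (hM.1.apply w z).symm
  rw [Matrix.det_fin_two] at h
  simp only [Matrix.submatrix_apply, Matrix.cons_val_zero, Matrix.cons_val_one, h3] at h
  have e1 : M z z = ((M z z).re : ℂ) := (Complex.eq_re_of_ofReal_le h1)
  have e2 : M w w = ((M w w).re : ℂ) := (Complex.eq_re_of_ofReal_le h2)
  have h1' : 0 ≤ (M z z).re := (Complex.le_def.1 h1).1
  have h2' : 0 ≤ (M w w).re := (Complex.le_def.1 h2).1
  rw [e1, e2, Complex.star_def, Complex.mul_conj, Complex.normSq_eq_norm_sq] at h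
  have h4 : 0 ≤ (M z z).re * (M w w).re - ‖M z w‖ ^ 2 := by exact_mod_cast h
  have : ‖M z w‖ ^ 2 ≤ (((M z z).re + (M w w).re) / 2) ^ 2 := by
    nlinarith [sq_nonneg ((M z z).re - (M w w).re)]
  exact le_of_sq_le_sq this (by positivity)

theorem posSemidef_prod {Ω ι : Type*} (s : Finset ι) (M : ι → Ω → Ω → ℂ)
    (hM : ∀ i ∈ s, (Matrix.of (M i)).PosSemidef) :
    (Matrix.of fun z w => ∏ i ∈ s, M i z w).PosSemidef := by
  classical
  induction s using Finset.induction_on with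
  | empty =>
    refine ⟨by ext z w; simp [Matrix.conjTranspose], fun x => ?_⟩
    have : (x.sum fun i xi => x.sum fun j xj =>
        star xi * (Matrix.of fun z w => ∏ i ∈ (∅ : Finset ι), M i z w) i j * xj)
        = star (x.sum fun _ a => a) * (x.sum fun _ a => a) := by
      simp only [Matrix.of_apply, Finset.prod_empty, mul_one, Finsupp.sum, star_sum,
        Finset.sum_mul_sum]
    rw [this]
    exact star_mul_self_nonneg _
  | insert i s hi ih =>
    have := (hM i (by simp)).hadamard (ih fun j hj => hM j (by simp [hj]))
    have e : (Matrix.of fun z w => ∏ j ∈ insert i s, M j z w)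
        = (Matrix.of (M i)).hadamard (Matrix.of fun z w => ∏ j ∈ s, M j z w) := by
      ext z w
      simp [Finset.prod_insert hi]
    rw [e]
    exact this

theorem prod_words {d k : ℕ} (c : Composition k)
    (f : ∀ m : ℕ, (Fin m → Fin d) → (Fin m → Fin d) → ℂ) :
    ∑ α : Fin k → Fin d, ∑ β : Fin k → Fin d,
      ∏ i, f (c.blocksFun i) (α ∘ c.embedding i) (β ∘ c.embedding i)
    = ∏ i, ∑ α, ∑ β, f (c.blocksFun i) α β := by
  let e : (Fin k → Fin d) ≃ (∀ i : Fin c.length, Fin (c.blocksFun i) → Fin d) :=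
    (Equiv.arrowCongr c.blocksFinEquiv.symm (Equiv.refl _)).trans
      (Equiv.piCurry fun _ _ => Fin d)
  have he : ∀ α i, e α i = α ∘ c.embedding i := fun α i => by
    ext j; simp [e, Composition.blocksFinEquiv, Sigma.curry]
  simp only [← he]
  rw [e.sum_comp (fun a => ∑ β, ∏ i, f (c.blocksFun i) (a i) (e β i))]
  have : ∀ a : (∀ i : Fin c.length, Fin (c.blocksFun i) → Fin d), ∑ β, ∏ i, f (c.blocksFun i) (a i) (e β i)
      = ∏ i, ∑ β, f (c.blocksFun i) (a i) β := fun a => by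
    rw [e.sum_comp (fun b => ∏ i, f (c.blocksFun i) (a i) (b i)), Fintype.prod_sum]
  simp only [this]
  rw [Fintype.prod_sum]

namespace AdmissibleSeq

variable {d : ℕ} (X : AdmissibleSeq d)

/-- `R_k² = ∑ X_{a(1)} ⊗ ⋯ ⊗ X_{a(l)}`, over all compositions `k = a(1) + ⋯ + a(l)` with positive
parts; `R_0² = I`. The entry of a tensor product at a pair of words `(α, β)` is the product of the
entries at the successive pairs of subwords. -/
def Rsq (k : ℕ) : Matrix (Fin k → Fin d) (Fin k → Fin d) ℂ :=
  Matrix.of fun α β => ∑ c : Composition k,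
    ∏ i, X.mat (c.blocksFun i) (α ∘ c.embedding i) (β ∘ c.embedding i)

/-- The positive square root `R_k`. -/
def R (k : ℕ) : Matrix (Fin k → Fin d) (Fin k → Fin d) ℂ := CFC.sqrt (X.Rsq k)

/-- For a matrix `A` on the `k`-th tensor power of `E = ℂ^d`, the matrix `I_E ⊗ A` on the
`(k+1)`-st. -/
def idTensor {k : ℕ} (A : Matrix (Fin k → Fin d) (Fin k → Fin d) ℂ) :
    Matrix (Fin (k + 1) → Fin d) (Fin (k + 1) → Fin d) ℂ :=
  Matrix.of fun α β => if α 0 = β 0 then A (Fin.tail α) (Fin.tail β) else 0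

/-- The weights `Z_0 = I` and `Z_k = R_k⁻¹ (I_E ⊗ R_{k-1})` for `k ≥ 1`. -/
def Z : ∀ k : ℕ, Matrix (Fin k → Fin d) (Fin k → Fin d) ℂ
  | 0 => 1
  | k + 1 => (X.R (k + 1))⁻¹ * idTensor (X.R k)

/-- The monomial `z_α = z_{α(1)} ⋯ z_{α(k)}`. -/
def monomial {k : ℕ} (z : Fin d → ℂ) (α : Fin k → Fin d) : ℂ := ∏ j, z (α j)

/-- `z^{(k)} A w^{(k)*} = ∑ z_α A_{α,β} conj(w_β)`. -/
def form {k : ℕ} (A : Matrix (Fin k → Fin d) (Fin k → Fin d) ℂ) (z w : Fin d → ℂ) : ℂ :=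
  ∑ α, ∑ β, monomial z α * A α β * starRingEnd ℂ (monomial w β)

/-- The domain `D(X, ℂ)` of all `z` for which `∑_{k ≥ 1} z^{(k)} X_k z^{(k)*}` converges to a number
less than `1`. -/
def domain : Set (Fin d → ℂ) :=
  {z | ∃ s : ℝ, s < 1 ∧ HasSum (fun k : ℕ => form (X.mat (k + 1)) z z) (s : ℂ)}

/-- The scalar kernel `K^R_c(z, w) = ∑_{k ≥ 0} z^{(k)} R_k² w^{(k)*}` on `D(X, ℂ)`. -/
def KRFun (z w : X.domain) : ℂ := ∑' k : ℕ, form (X.Rsq k) z w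

theorem form_posSemidef {k : ℕ} {A : Matrix (Fin k → Fin d) (Fin k → Fin d) ℂ}
    (hA : A.PosSemidef) {Ω : Type*} (v : Ω → Fin d → ℂ) :
    (Matrix.of fun z w => form A (v z) (v w)).PosSemidef := by
  refine ⟨?_, fun x => ?_⟩
  · ext z w
    simp only [Matrix.conjTranspose_apply, Matrix.of_apply, form, star_sum, star_mul']
    rw [Finset.sum_comm]
    refine Finset.sum_congr rfl fun α _ => Finset.sum_congr rfl fun β _ => ?_
    rw [hA.1.apply]
    simp only [Complex.star_def, Complex.conj_conj]
    ring
  · have h := hA.dotProduct_mulVec_nonneg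
      (fun β => x.sum fun w xw => starRingEnd ℂ (monomial (v w) β) * xw)
    refine le_of_le_of_eq h ?_
    simp only [dotProduct, Matrix.mulVec, Finsupp.sum, Pi.star_apply, star_sum, Matrix.of_apply,
      form, Finset.sum_mul, Finset.mul_sum]
    rw [Finset.sum_congr rfl fun α _ => Finset.sum_congr rfl fun β _ => Finset.sum_comm]
    rw [Finset.sum_congr rfl fun α _ => Finset.sum_comm, Finset.sum_comm]
    refine Finset.sum_congr rfl fun i _ => ?_
    rw [Finset.sum_congr rfl fun α _ => Finset.sum_comm, Finset.sum_comm]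
    refine Finset.sum_congr rfl fun j _ => Finset.sum_congr rfl fun α _ =>
      Finset.sum_congr rfl fun β _ => ?_
    simp only [star_mul', Complex.star_def, Complex.conj_conj]
    ring

theorem posSemidef_of_hasSum {Ω : Type*} {M : ℕ → Matrix Ω Ω ℂ} {N : Matrix Ω Ω ℂ}
    (hM : ∀ k, (M k).PosSemidef) (h : ∀ z w, HasSum (fun k => M k z w) (N z w)) :
    N.PosSemidef := by
  refine ⟨?_, fun x => ?_⟩
  · ext z w
    rw [Matrix.conjTranspose_apply]
    refine (h w z).star.unique ?_
    simpa only [(hM _).1.apply] using h z w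
  · have : HasSum (fun k => x.sum fun i xi => x.sum fun j xj => star xi * M k i j * xj)
        (x.sum fun i xi => x.sum fun j xj => star xi * N i j * xj) :=
      hasSum_sum fun i _ => hasSum_sum fun j _ => ((h i j).mul_left _).mul_right _
    exact this.nonneg fun k => (hM k).2 x

theorem form_Rsq (k : ℕ) (z w : Fin d → ℂ) :
    form (X.Rsq k) z w = ∑ c : Composition k, ∏ i, form (X.mat (c.blocksFun i)) z w := by
  have h : ∀ c : Composition k, ∏ i, form (X.mat (c.blocksFun i)) z w = ∑ α, ∑ β,
      monomial z α * (∏ i, X.mat (c.blocksFun i) (α ∘ c.embedding i) (β ∘ c.embedding i)) *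
        starRingEnd ℂ (monomial w β) := by
    intro c
    simp only [form]
    rw [← prod_words c fun m α β => monomial z α * X.mat m α β * starRingEnd ℂ (monomial w β)]
    refine Finset.sum_congr rfl fun α _ => Finset.sum_congr rfl fun β _ => ?_
    rw [Finset.prod_mul_distrib, Finset.prod_mul_distrib, ← map_prod]
    rw [show ∏ i, monomial z (α ∘ c.embedding i) = monomial z α from
        c.prod_prod_apply_embedding fun j => z (α j),
      show ∏ i, monomial w (β ∘ c.embedding i) = monomial w β from
        c.prod_prod_apply_embedding fun j => w (β j)]
  rw [Finset.sum_congr rfl fun c _ => h c, Finset.sum_comm]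
  refine Finset.sum_congr rfl fun α _ => ?_
  rw [Finset.sum_comm]
  refine Finset.sum_congr rfl fun β _ => ?_
  simp only [Rsq, Matrix.of_apply, Finset.mul_sum, Finset.sum_mul]

theorem summable_KR (z w : X.domain) : Summable fun k : ℕ => form (X.Rsq k) z w := by
  obtain ⟨s, hs1, hs⟩ := z.2
  obtain ⟨t, ht1, ht⟩ := w.2
  have hle : ∀ k, ‖form (X.mat (k + 1)) z w‖ ≤
      ((form (X.mat (k + 1)) z z).re + (form (X.mat (k + 1)) w w).re) / 2 := fun k =>
    norm_le_of_posSemidef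
      (form_posSemidef (X.posSemidef (k + 1) (by omega)) fun u : X.domain => (u : Fin d → ℂ)) z w
  have hsum : HasSum (fun k : ℕ => ((form (X.mat (k + 1)) z z).re +
      (form (X.mat (k + 1)) w w).re) / 2) ((s + t) / 2) := by
    have h1 := Complex.hasSum_re hs
    have h2 := Complex.hasSum_re ht
    simpa using (h1.add h2).div_const 2
  have hS : Summable fun k => ‖form (X.mat (k + 1)) z w‖ :=
    hsum.summable.of_nonneg_of_le (fun _ => norm_nonneg _) hle
  have hlt : ∑' k, ‖form (X.mat (k + 1)) z w‖ < 1 :=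
    (hS.tsum_le_tsum hle hsum.summable).trans_lt (by rw [hsum.tsum_eq]; linarith)
  refine (summable_prod_composition (p := fun k => ‖form (X.mat k) z w‖)
    (fun _ => norm_nonneg _) hS hlt).of_norm_bounded fun k => ?_
  rw [X.form_Rsq]
  refine (norm_sum_le _ _).trans (le_of_eq ?_)
  simp only [norm_prod]

theorem KR_posSemidef : (Matrix.of X.KRFun).PosSemidef := by
  refine posSemidef_of_hasSum (M := fun k => Matrix.of fun z w : X.domain => form (X.Rsq k) z w)
    (fun k => ?_) fun z w => (X.summable_KR z w).hasSum
  simp only [X.form_Rsq]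
  have := Matrix.posSemidef_sum (x := fun c : Composition k => Matrix.of fun z w : X.domain =>
      ∏ i, form (X.mat (c.blocksFun i)) z w) Finset.univ fun c _ =>
    posSemidef_prod Finset.univ (fun i (z w : X.domain) => form (X.mat (c.blocksFun i)) z w)
      fun i _ => form_posSemidef (X.posSemidef _ (c.one_le_blocksFun i))
        fun u : X.domain => (u : Fin d → ℂ)
  convert this using 1
  ext z w
  simp [Matrix.sum_apply]

/-- `K^R_c` as a positive definite kernel; its space is `E_{K^R_c}`. -/
def KR : PDKernel X.domain := ⟨X.KRFun, X.KR_posSemidef⟩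

/-! ### The weighted Drury-Arveson space and the weighted shifts -/

/-- The full Fock space of `ℂ^d`. -/
abbrev Fock (d : ℕ) : Type := lp (fun k : ℕ => EuclideanSpace ℂ (Fin k → Fin d)) 2

/-- The symmetric `k`-th tensor power of `ℂ^d`. -/
def symPower (d k : ℕ) : Submodule ℂ (EuclideanSpace ℂ (Fin k → Fin d)) where
  carrier := {v | ∀ (σ : Equiv.Perm (Fin k)) (α : Fin k → Fin d), v (α ∘ σ) = v α}
  add_mem' hv hw σ α := by simp [hv σ α, hw σ α]
  zero_mem' _ _ := by simp
  smul_mem' c v hv σ α := by simp [hv σ α]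

/-- `R_k` applied to the symmetric `k`-th tensor power of `ℂ^d`. -/
def level (k : ℕ) : Submodule ℂ (EuclideanSpace ℂ (Fin k → Fin d)) :=
  (symPower d k).map (Matrix.toEuclideanLin (X.R k))

/-- The weighted Drury-Arveson space `F(R) = ⊕_k R_k (ℂ^d)^{Ⓢ k}`, inside the full Fock space. -/
def FR : Submodule ℂ (Fock d) where
  carrier := {ξ | ∀ k, ξ k ∈ X.level k}
  add_mem' hξ hη k := by simpa using (X.level k).add_mem (hξ k) (hη k)
  zero_mem' k := by simp
  smul_mem' c ξ hξ k := by simpa using (X.level k).smul_mem c (hξ k)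

theorem isClosed_FR : IsClosed (X.FR : Set (Fock d)) := by
  have : (X.FR : Set (Fock d)) = ⋂ k, (fun ξ : Fock d => ξ k) ⁻¹' (X.level k : Set _) := by
    ext ξ; simp only [SetLike.mem_coe, Set.mem_iInter, Set.mem_preimage]; rfl
  rw [this]
  refine isClosed_iInter fun k => (X.level k).closed_of_finiteDimensional.preimage ?_
  exact (lp.evalCLM ℂ _ 2 k).continuous

instance : CompleteSpace X.FR := X.isClosed_FR.completeSpace_coe

/-- `e_i ⊗ θ`. -/
def tensorLeft (i : Fin d) {k : ℕ} (θ : EuclideanSpace ℂ (Fin k → Fin d)) :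
    EuclideanSpace ℂ (Fin (k + 1) → Fin d) :=
  WithLp.toLp 2 fun α => if α 0 = i then θ (Fin.tail α) else 0

/-- `A` is the weighted shift with `A θ = Z_{k+1} (e_i ⊗ θ)` for `θ` in the `k`-th tensor power. -/
def IsWeightedShift (i : Fin d) (A : Fock d →L[ℂ] Fock d) : Prop :=
  ∀ ξ : Fock d, (A ξ) 0 = 0 ∧
    ∀ k, (A ξ) (k + 1) = Matrix.toEuclideanLin (X.Z (k + 1)) (tensorLeft i (ξ k))

/-- `w^{(k)*}`, the vector with entries `conj(w_α)`. -/
def powStar (w : Fin d → ℂ) (k : ℕ) : EuclideanSpace ℂ (Fin k → Fin d) :=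
  WithLp.toLp 2 fun α => starRingEnd ℂ (monomial w α)

/-! ### The contractivity condition -/

section Contractive

variable {H : Type*} [NormedAddCommGroup H] [InnerProductSpace ℂ H] [CompleteSpace H]

/-- `T_α = T_{α(1)} ⋯ T_{α(k)}`. -/
def wordOp (T : Fin d → H →L[ℂ] H) {k : ℕ} (α : Fin k → Fin d) : H →L[ℂ] H :=
  (List.ofFn fun j => T (α j)).prod

/-- `T^{(k)} (X_k ⊗ I) T^{(k)*} = ∑ x_{α,β} T_α T_β^*`, over words of length `k`. -/
def phiTerm (T : Fin d → H →L[ℂ] H) (k : ℕ) : H →L[ℂ] H :=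
  ∑ α, ∑ β, X.mat k α β • (wordOp T α ∘L ContinuousLinearMap.adjoint (wordOp T β))

/-- `∑_{k ≥ 1} T^{(k)} (X_k ⊗ I) T^{(k)*}` converges (in the weak operator topology; the terms are
positive) to an operator `Φ` with `Φ ≤ I`. -/
def IsContractiveTuple (T : Fin d → H →L[ℂ] H) : Prop :=
  ∃ Φ : H →L[ℂ] H,
    (∀ f g : H, HasSum (fun k : ℕ => ⟪f, X.phiTerm T (k + 1) g⟫_ℂ) ⟪f, Φ g⟫_ℂ) ∧ Φ ≤ 1

end Contractive

end AdmissibleSeq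

end

/-! Write `s(z,w)` for the sum of `z^{(k)} X_k w^{(k)*}` over `k ≥ 1`. Since `R_k²` sums over all
compositions of `k`, `K^R_c` is the geometric series in `s`, and `K^R_c · (1 - s) = 1`
(`KRFun_mul`).

Let `T_i = M_{z_i} ⊗ I`, let `P` be the projection onto an invariant subspace, and let `Φ_k(B) = ∑
x_{α,β} T_α B T_β^*`. Invariance gives `P T_α P = T_α P`. Hence `P - ∑ Φ_k(P)` is the compression by
`P` of `(I - ∑ Φ_k(I)) + ∑ Φ_k(I - P)`, which is positive (`sum_phiMap_le`). Between point
evaluations `ev_z` and `ev_w^*`, each `Φ_k(P)` becomes the scalar `z^{(k)} X_k w^{(k)*}` times `ev_z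
P ev_w^*`. So `L(z,w) = (1 - s(z,w)) ev_z P ev_w^*` is a positive operator-valued kernel.

Let `D` be the reproducing kernel space of `L` and `Θ(z)` its evaluation at `z`. Then `L(z,w) = Θ(z)
Θ(w)^*`, and `ev_z P ev_w^* = K^R_c(z,w) Θ(z) Θ(w)^*`. This says that `ev_w^* g ↦ k_w ⊗ Θ(w)^* g`
extends to an operator `V` with `V^* V = P`; its adjoint is `M_Θ`, a partial isometry with range
`S`. Conversely, multiplication operators intertwine the coordinate multiplications, so their ranges
are invariant.

This argument (`exists_partialIsometric_multiplier`) needs only a space with kernel `K^R_c` as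
source, so it serves both `E_{K^R_c}` and `F(R)`. It remains to bound the shifts, to show that the
vectors `⊕ R_k w^{(k)*}` are total in `F(R)`, and to check contractivity of `W`, which follows from
`K^R_c · (1 - s) = 1`. -/

noncomputable section

/-! ### Ampliations and evaluations on Hilbert space tensor products. -/

namespace HTensor

variable {E E' E'' F : Type*} [NormedAddCommGroup E] [InnerProductSpace ℂ E]
  [NormedAddCommGroup E'] [InnerProductSpace ℂ E'] [NormedAddCommGroup E''] [InnerProductSpace ℂ E'']
  [NormedAddCommGroup F] [InnerProductSpace ℂ F]

theorem clm_ext {H : Type*} [NormedAddCommGroup H] [InnerProductSpace ℂ H]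
    {A B : HTensor E F →L[ℂ] H}
    (h : ∀ x y, A (incl E F (x ⊗ₜ[ℂ] y)) = B (incl E F (x ⊗ₜ[ℂ] y))) : A = B := by
  have h1 : ∀ t, A (incl E F t) = B (incl E F t) := by
    intro t
    induction t with
    | zero => simp
    | tmul x y => exact h x y
    | add s t hs ht => simp [hs, ht]
  ext f
  exact congrFun (denseRange_incl.equalizer A.continuous B.continuous (funext h1)) f

theorem inner_incl_tmul (x x' : E) (y y' : F) :
    ⟪incl E F (x ⊗ₜ[ℂ] y), incl E F (x' ⊗ₜ[ℂ] y')⟫_ℂ = ⟪x, x'⟫_ℂ * ⟪y, y'⟫_ℂ := by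
  rw [LinearIsometry.inner_map_map, TensorProduct.inner_tmul]

theorem ampliation_tmul (A : E →L[ℂ] E') (x : E) (y : F) :
    ampliation A F (incl E F (x ⊗ₜ[ℂ] y)) = incl E' F (A x ⊗ₜ[ℂ] y) := by
  rw [ampliation_incl]; rfl

theorem ampliation_one : ampliation (1 : E →L[ℂ] E) F = 1 :=
  clm_ext fun x y => by simp [ampliation_tmul]

theorem ampliation_comp (A : E' →L[ℂ] E'') (B : E →L[ℂ] E') :
    ampliation (A ∘L B) F = ampliation A F ∘L ampliation B F :=
  clm_ext fun x y => by simp [ampliation_tmul]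

theorem ampliation_add (A B : E →L[ℂ] E') :
    ampliation (A + B) F = ampliation A F + ampliation B F :=
  clm_ext fun x y => by simp [ampliation_tmul, TensorProduct.add_tmul]

theorem ampliation_smul (c : ℂ) (A : E →L[ℂ] E') :
    ampliation (c • A) F = c • ampliation A F :=
  clm_ext fun x y => by simp [ampliation_tmul, ← TensorProduct.smul_tmul']

variable (E E' F) in
/-- The ampliation `A ↦ A ⊗ I_F`, as a linear map. -/
def ampliationₗ : (E →L[ℂ] E') →ₗ[ℂ] (HTensor E F →L[ℂ] HTensor E' F) where
  toFun A := ampliation A F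
  map_add' := ampliation_add
  map_smul' := ampliation_smul

theorem ampliation_sum {ι : Type*} (s : Finset ι) (A : ι → E →L[ℂ] E') :
    ampliation (∑ i ∈ s, A i) F = ∑ i ∈ s, ampliation (A i) F :=
  map_sum (ampliationₗ E E' F) A s

theorem ampliation_sub (A B : E →L[ℂ] E') :
    ampliation (A - B) F = ampliation A F - ampliation B F :=
  map_sub (ampliationₗ E E' F) A B

theorem ampliation_adjoint [CompleteSpace E] [CompleteSpace E'] (A : E →L[ℂ] E') :
    ampliation (ContinuousLinearMap.adjoint A) F =
      ContinuousLinearMap.adjoint (ampliation A F) := by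
  refine clm_ext fun x y => ?_
  refine ext_inner_right ℂ fun f => ?_
  rw [ContinuousLinearMap.adjoint_inner_left, ampliation_tmul]
  have : (innerSL ℂ (incl E F (ContinuousLinearMap.adjoint A x ⊗ₜ[ℂ] y))) =
      (innerSL ℂ (incl E' F (x ⊗ₜ[ℂ] y))) ∘L ampliation A F := by
    refine clm_ext fun x' y' => ?_
    simp [ampliation_tmul, ContinuousLinearMap.adjoint_inner_left]
  simpa using congrArg (fun B => B f) this

theorem ampliation_list_prod (l : List (E →L[ℂ] E)) :
    ampliation l.prod F = (l.map fun A => ampliation A F).prod := by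
  induction l with
  | nil => exact ampliation_one
  | cons A l ih =>
    rw [List.prod_cons, List.map_cons, List.prod_cons, ← ih]
    exact ampliation_comp A l.prod

/-- Ampliation respects products and adjoints, so a factorization `B^* B` survives it. -/
theorem ampliation_nonneg [CompleteSpace E] {A : E →L[ℂ] E} (hA : 0 ≤ A) :
    0 ≤ ampliation A F := by
  obtain ⟨B, rfl⟩ := CStarAlgebra.nonneg_iff_eq_star_mul_self.1 hA
  have : ampliation (star B * B) F = star (ampliation B F) * ampliation B F := by
    rw [ContinuousLinearMap.star_eq_adjoint, ContinuousLinearMap.star_eq_adjoint,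
      ← ampliation_adjoint]
    exact ampliation_comp _ _
  rw [this]
  exact star_mul_self_nonneg _

theorem ampliation_le_one [CompleteSpace E] {A : E →L[ℂ] E} (hA : A ≤ 1) :
    ampliation A F ≤ 1 := by
  rw [← sub_nonneg] at hA ⊢
  rw [← ampliation_one, ← ampliation_sub]
  exact ampliation_nonneg hA

variable [CompleteSpace F]

theorem slice_ampliation (φ : E' →L[ℂ] ℂ) (A : E →L[ℂ] E') :
    slice φ F ∘L ampliation A F = slice (φ ∘L A) F :=
  clm_ext fun x y => by simp [ampliation_tmul, slice_tmul]

theorem slice_smul (c : ℂ) (φ : E →L[ℂ] ℂ) : slice (c • φ) F = c • slice φ F :=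
  clm_ext fun x y => by simp [slice_tmul, mul_smul]

/-- The Riesz vector of an evaluation is a kernel function `k_z`, so these are the vectors `k_z ⊗ g`
on which adjoints of multiplication operators are explicit. -/
theorem adjoint_slice [CompleteSpace E] (φ : E →L[ℂ] ℂ) (g : F) :
    ContinuousLinearMap.adjoint (slice φ F) g =
      incl E F ((InnerProductSpace.toDual ℂ E).symm φ ⊗ₜ[ℂ] g) := by
  refine ext_inner_right ℂ fun f => ?_
  rw [ContinuousLinearMap.adjoint_inner_left]
  have : (innerSL ℂ g) ∘L slice φ F =
      (innerSL ℂ (incl E F ((InnerProductSpace.toDual ℂ E).symm φ ⊗ₜ[ℂ] g))) := by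
    refine clm_ext fun x' y' => ?_
    simp [slice_tmul]
  simpa using congrArg (fun B => B f) this

/-- This makes `E ⊗ F` a genuine space of `F`-valued functions: pairing with a fixed `g` in `F`
reduces the claim to scalar functions in `E`. -/
theorem eq_zero_of_slice_eq_zero [CompleteSpace E] {Ω : Type*} {e : Ω → E →L[ℂ] ℂ}
    (he : ∀ x, (∀ z, e z x = 0) → x = 0) {f : HTensor E F} (hf : ∀ z, slice (e z) F f = 0) :
    f = 0 := by
  refine denseRange_incl.eq_zero_of_inner_right ℂ fun t => ?_
  induction t with
  | zero => simp
  | add s t hs ht => simp [inner_add_left, hs, ht]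
  | tmul x g =>
    -- `J x = x ⊗ g`, so `J^* f` is the element of `E` with values `⟪g, f(z)⟫`.
    let J : E →L[ℂ] HTensor E F := (incl E F).toContinuousLinearMap ∘L
      (TensorProduct.mkL ℂ E F).flip g
    have hJ : ∀ x, J x = incl E F (x ⊗ₜ[ℂ] g) := fun x => rfl
    have h0 : ContinuousLinearMap.adjoint J f = 0 := he _ fun z => by
      rw [← InnerProductSpace.toDual_symm_apply, ContinuousLinearMap.adjoint_inner_right, hJ,
        ← adjoint_slice, ContinuousLinearMap.adjoint_inner_left, hf, inner_zero_right]
    rw [← hJ, ← ContinuousLinearMap.adjoint_inner_right, h0, inner_zero_right]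

end HTensor

/-! ### Operators prescribed on total families, and partial isometries. -/

theorem denseRange_linearCombination {E ι : Type*} [NormedAddCommGroup E] [InnerProductSpace ℂ E]
    [CompleteSpace E] {a : ι → E} (ha : ∀ x : E, (∀ i, ⟪a i, x⟫_ℂ = 0) → x = 0) :
    DenseRange (Finsupp.linearCombination ℂ a) := by
  have : (LinearMap.range (Finsupp.linearCombination ℂ a)).topologicalClosure = ⊤ := by
    rw [Submodule.topologicalClosure_eq_top_iff, Submodule.eq_bot_iff]
    intro x hx
    refine ha x fun i => hx (a i) ⟨Finsupp.single i 1, by simp⟩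
  rw [DenseRange, ← LinearMap.coe_range, Submodule.dense_iff_topologicalClosure_eq_top, this]

section Partial

variable {E F : Type*} [NormedAddCommGroup E] [InnerProductSpace ℂ E] [CompleteSpace E]
  [NormedAddCommGroup F] [InnerProductSpace ℂ F] [CompleteSpace F]

open ContinuousLinearMap

/-- The Gram identity makes `∑ cᵢ aᵢ ↦ ∑ cᵢ bᵢ` well defined with norm at most `√‖Q‖` on a dense
subspace. Taking for `Q` a projection yields the adjoint of the multiplier; `Q = 1` yields the
identification with `F(R)`. -/
theorem exists_clm_of_inner_eq {ι : Type*} (a : ι → E) (b : ι → F) (Q : E →L[ℂ] E)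
    (ha : ∀ x : E, (∀ i, ⟪a i, x⟫_ℂ = 0) → x = 0)
    (h : ∀ i j, ⟪b i, b j⟫_ℂ = ⟪a i, Q (a j)⟫_ℂ) :
    ∃ V : E →L[ℂ] F, (∀ i, V (a i) = b i) ∧ adjoint V ∘L V = Q := by
  let A : (ι →₀ ℂ) →ₗ[ℂ] E := Finsupp.linearCombination ℂ a
  let B : (ι →₀ ℂ) →ₗ[ℂ] F := Finsupp.linearCombination ℂ b
  have hA : DenseRange A := denseRange_linearCombination ha
  have hAB : ∀ x y, ⟪B x, B y⟫_ℂ = ⟪A x, Q (A y)⟫_ℂ := by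
    intro x y
    simp only [A, B, Finsupp.linearCombination_apply, Finsupp.sum, map_sum, sum_inner, inner_sum,
      map_smul, inner_smul_left, inner_smul_right, h]
  have hn : ∀ x, ‖B x‖ ≤ Real.sqrt ‖Q‖ * ‖A x‖ := by
    intro x
    refine le_of_sq_le_sq ?_ (by positivity)
    rw [mul_pow, Real.sq_sqrt (norm_nonneg _), ← inner_self_eq_norm_sq (𝕜 := ℂ) (B x), hAB]
    calc RCLike.re ⟪A x, Q (A x)⟫_ℂ ≤ ‖⟪A x, Q (A x)⟫_ℂ‖ := RCLike.re_le_norm _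
      _ ≤ ‖A x‖ * ‖Q (A x)‖ := norm_inner_le_norm _ _
      _ ≤ ‖A x‖ * (‖Q‖ * ‖A x‖) := by gcongr; exact Q.le_opNorm _
      _ = _ := by ring
  have hV : ∀ x, B.extendOfNorm A (A x) = B x :=
    LinearMap.extendOfNorm_eq hA ⟨_, hn⟩
  refine ⟨B.extendOfNorm A, fun i => by simpa [A, B] using hV (Finsupp.single i 1), ?_⟩
  refine coeFn_injective (hA.equalizer (map_continuous _) Q.continuous (funext fun x => ?_))
  refine hA.eq_of_inner_right ℂ fun y => ?_
  simp only [Function.comp_apply, coe_comp, adjoint_inner_right, hV]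
  exact hAB y x

/-- From `P P^*` being the projection onto `S` it follows that `P^*` kills `Sᗮ`, so `P` maps into
`S` and `P P^* P = P`. Thus `P^* P` fixes every vector orthogonal to the kernel. -/
theorem isPartialIsometry_of_comp_adjoint {P : E →L[ℂ] F} (S : Submodule ℂ F)
    [S.HasOrthogonalProjection] (h : P ∘L adjoint P = S.starProjection) :
    IsPartialIsometry P ∧ (S : Set F) = Set.range P := by
  have h' : ∀ y, P (adjoint P y) = S.starProjection y := fun y => congrArg (fun B => B y) h
  have hadj : ∀ y, adjoint P (S.starProjection y) = adjoint P y := by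
    intro y
    rw [← sub_eq_zero, ← map_sub, ← inner_self_eq_zero (𝕜 := ℂ), adjoint_inner_left, h', map_sub]
    rw [Submodule.starProjection_eq_self_iff.2 (S.starProjection_apply_mem y), sub_self, inner_zero_right]
  have hP : ∀ x, S.starProjection (P x) = P x := by
    intro x
    refine ext_inner_right ℂ fun y => ?_
    rw [Submodule.inner_starProjection_left_eq_right, ← adjoint_inner_right, hadj,
      adjoint_inner_right]
  refine ⟨fun x hx => ?_, ?_⟩
  · have h1 : x - adjoint P (P x) ∈ LinearMap.ker (P : E →ₗ[ℂ] F) := by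
      simp [h', hP]
    have h2 : x - adjoint P (P x) ∈ (LinearMap.ker (P : E →ₗ[ℂ] F))ᗮ := by
      refine Submodule.sub_mem _ hx fun y hy => ?_
      rw [adjoint_inner_right]
      rw [show P y = 0 from hy, inner_zero_left]
    have h3 : adjoint P (P x) = x := by
      have := (Submodule.orthogonal_disjoint _).le_bot ⟨h1, h2⟩
      rw [Submodule.mem_bot, sub_eq_zero] at this
      exact this.symm
    have h4 : ⟪P x, P x⟫_ℂ = ⟪x, x⟫_ℂ := by rw [← adjoint_inner_right, h3]
    rw [inner_self_eq_norm_sq_to_K, inner_self_eq_norm_sq_to_K] at h4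
    exact (sq_eq_sq₀ (norm_nonneg _) (norm_nonneg _)).1 (by exact_mod_cast h4)
  · ext y
    constructor
    · intro hy
      exact ⟨adjoint P y, by rw [h', Submodule.starProjection_eq_self_iff.2 hy]⟩
    · rintro ⟨x, rfl⟩
      exact Submodule.starProjection_eq_self_iff.1 (hP x)

end Partial

/-! ### Splitting off the first block of a composition. -/

namespace Composition

/-- The composition with first block `j + 1` and remaining blocks those of `c`. -/
def consBlock (j : ℕ) {k n : ℕ} (h : j + k = n) (c : Composition k) : Composition (n + 1) where
  blocks := (j + 1) :: c.blocks
  blocks_pos := by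
    intro i hi
    rcases List.mem_cons.1 hi with rfl | hi
    · omega
    · exact c.blocks_pos hi
  blocks_sum := by rw [List.sum_cons, c.blocks_sum]; omega

/-- Splitting off the first block gives the recursion for the coefficients of `1 / (1 - ∑ aₖ)`.
Blocks are positive, hence the shift `p.1 + 1`. -/
theorem sum_prod_succ (a : ℕ → ℂ) (n : ℕ) :
    ∑ c : Composition (n + 1), ∏ i, a (c.blocksFun i) =
      ∑ p ∈ Finset.HasAntidiagonal.antidiagonal n, a (p.1 + 1) * ∑ c : Composition p.2, ∏ i, a (c.blocksFun i) := by
  have key : ∀ (n : ℕ) (c : Composition n), ∏ i, a (c.blocksFun i) = (c.blocks.map a).prod := by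
    intro n c
    rw [← c.ofFn_blocksFun, List.map_ofFn, List.prod_ofFn]
    rfl
  simp only [key, Finset.mul_sum]
  rw [Finset.sum_sigma']
  symm
  refine Finset.sum_bij (fun p hp => consBlock p.1.1
    (Finset.HasAntidiagonal.mem_antidiagonal.1 (Finset.mem_sigma.1 hp).1) p.2) (fun _ _ => Finset.mem_univ _)
    ?_ ?_ ?_
  · rintro ⟨⟨j, k⟩, c⟩ h ⟨⟨j', k'⟩, c'⟩ h' heq
    have hb := congrArg Composition.blocks heq
    simp only [consBlock, List.cons.injEq, Nat.add_right_cancel_iff] at hb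
    obtain ⟨rfl, hb⟩ := hb
    have hk : (⟨k, c⟩ : Σ n, Composition n) = ⟨k', c'⟩ := sigma_eq_iff_blocks_eq.2 hb
    cases hk
    rfl
  · intro c _
    obtain ⟨b, pos, hs⟩ := c
    cases b with
    | nil => simp at hs
    | cons x b =>
      have hx : 0 < x := pos (by simp)
      rw [List.sum_cons] at hs
      refine ⟨⟨(x - 1, b.sum), ⟨b, fun h => pos (by simp [h]), rfl⟩⟩, ?_, ?_⟩
      · simp; omega
      · ext1
        simp [consBlock, Nat.sub_add_cancel hx]
  · rintro ⟨⟨j, k⟩, c⟩ h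
    simp [consBlock]

end Composition

/-! ### The kernel as a geometric series; positivity of the matrices `R_k²`. -/

namespace AdmissibleSeq

variable {d : ℕ} (X : AdmissibleSeq d)

/-- The sum `∑_{k ≥ 1} z^{(k)} X_k w^{(k)*}`. -/
def symbol (z w : Fin d → ℂ) : ℂ := ∑' k : ℕ, form (X.mat (k + 1)) z w

theorem summable_symbol (z w : X.domain) :
    Summable fun k : ℕ => form (X.mat (k + 1)) (z : Fin d → ℂ) w := by
  obtain ⟨s, hs1, hs⟩ := z.2
  obtain ⟨t, ht1, ht⟩ := w.2
  refine (((Complex.hasSum_re hs).summable.add (Complex.hasSum_re ht).summable).div_const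
    2).of_norm_bounded fun k => ?_
  exact norm_le_of_posSemidef
    (form_posSemidef (X.posSemidef (k + 1) (by omega)) fun u : X.domain => (u : Fin d → ℂ)) z w

theorem form_Rsq_zero (z w : Fin d → ℂ) : form (X.Rsq 0) z w = 1 := by
  have h : (Finset.univ : Finset (Composition 0)) = {Composition.ones 0} := by
    refine Finset.eq_singleton_iff_unique_mem.2 ⟨Finset.mem_univ _, fun c _ => ?_⟩
    exact Composition.eq_ones_iff_length.2 (c.length_eq_zero.2 rfl)
  have : IsEmpty (Fin (Composition.ones 0).length) := by
    rw [Composition.ones_length]; infer_instance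
  rw [X.form_Rsq, h, Finset.sum_singleton, Finset.univ_eq_empty, Finset.prod_empty]

/-- By the Cauchy product and the first-block recursion, multiplying by the symbol removes exactly
the term `k = 0` of the kernel, which is `1`. -/
theorem KRFun_mul (z w : X.domain) : X.KRFun z w * (1 - X.symbol z w) = 1 := by
  have h1 := X.summable_symbol z w
  have h2 := X.summable_KR z w
  have h3 := tsum_mul_tsum_eq_tsum_sum_antidiagonal_of_summable_norm h1.norm h2.norm
  have h4 : ∀ n, ∑ p ∈ Finset.HasAntidiagonal.antidiagonal n, form (X.mat (p.1 + 1)) (z : Fin d → ℂ) w *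
      form (X.Rsq p.2) z w = form (X.Rsq (n + 1)) z w := by
    intro n
    simp only [X.form_Rsq]
    exact (Composition.sum_prod_succ (fun k => form (X.mat k) (z : Fin d → ℂ) w) n).symm
  simp only [h4] at h3
  have h5 := h2.tsum_eq_zero_add
  rw [form_Rsq_zero] at h5
  rw [mul_sub, mul_one, mul_comm]
  unfold KRFun symbol
  rw [h3, h5]
  ring

/-! ### The matrices `R_k` -/

theorem mat_one_posDef : (X.mat 1).PosDef :=
  (X.posSemidef 1 le_rfl).posDef_iff_isUnit.2 X.isUnit_one

/-- The summand of `R_k²` belonging to a composition. -/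
def RsqTerm {k : ℕ} (c : Composition k) : Matrix (Fin k → Fin d) (Fin k → Fin d) ℂ :=
  Matrix.of fun α β => ∏ i, X.mat (c.blocksFun i) (α ∘ c.embedding i) (β ∘ c.embedding i)

theorem Rsq_eq_sum (k : ℕ) : X.Rsq k = ∑ c : Composition k, X.RsqTerm c := by
  ext α β
  simp [Rsq, RsqTerm, Matrix.sum_apply]

theorem RsqTerm_posSemidef {k : ℕ} (c : Composition k) : (X.RsqTerm c).PosSemidef :=
  posSemidef_prod Finset.univ
    (fun i α β => X.mat (c.blocksFun i) (α ∘ c.embedding i) (β ∘ c.embedding i)) fun i _ =>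
      (X.posSemidef _ (c.one_le_blocksFun i)).submatrix fun α : Fin k → Fin d => α ∘ c.embedding i

theorem Rsq_posSemidef (k : ℕ) : (X.Rsq k).PosSemidef := by
  rw [Rsq_eq_sum]
  exact Matrix.posSemidef_sum _ fun c _ => X.RsqTerm_posSemidef c

/-- The tensor product `A ⊗ B`, for `A` acting on `ℂ^d` and `B` on the `k`-th tensor power. -/
def tensor {k : ℕ} (A : Matrix (Fin 1 → Fin d) (Fin 1 → Fin d) ℂ)
    (B : Matrix (Fin k → Fin d) (Fin k → Fin d) ℂ) :
    Matrix (Fin (k + 1) → Fin d) (Fin (k + 1) → Fin d) ℂ :=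
  (Matrix.kronecker A B).submatrix (fun α => (fun _ => α 0, Fin.tail α))
    (fun α => (fun _ => α 0, Fin.tail α))

theorem tensor_apply {k : ℕ} (A : Matrix (Fin 1 → Fin d) (Fin 1 → Fin d) ℂ)
    (B : Matrix (Fin k → Fin d) (Fin k → Fin d) ℂ) (α β : Fin (k + 1) → Fin d) :
    tensor A B α β = A (fun _ => α 0) (fun _ => β 0) * B (Fin.tail α) (Fin.tail β) := rfl

theorem tensor_posSemidef {k : ℕ} {A : Matrix (Fin 1 → Fin d) (Fin 1 → Fin d) ℂ}
    {B : Matrix (Fin k → Fin d) (Fin k → Fin d) ℂ} (hA : A.PosSemidef) (hB : B.PosSemidef) :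
    (tensor A B).PosSemidef :=
  (hA.kronecker hB).submatrix _

theorem RsqTerm_consBlock {k : ℕ} (c : Composition k) :
    X.RsqTerm (c.consBlock 0 (Nat.zero_add k)) = tensor (X.mat 1) (X.RsqTerm c) := by
  ext α β
  rw [tensor_apply]
  simp only [RsqTerm, Matrix.of_apply]
  refine (Fin.prod_univ_succ (n := c.length) _).trans ?_
  have h0 : ∀ α : Fin (k + 1) → Fin d,
      α ∘ (c.consBlock 0 (Nat.zero_add k)).embedding (0 : Fin (c.length + 1)) = fun _ => α 0 := by
    intro α
    funext j
    refine congrArg α (Fin.ext ?_)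
    have hj : (j : ℕ) < 1 := j.2
    change (c.consBlock 0 (Nat.zero_add k)).sizeUpTo 0 + (j : ℕ) = 0
    rw [Composition.sizeUpTo_zero]
    omega
  have h1 : ∀ (α : Fin (k + 1) → Fin d) (i : Fin c.length),
      α ∘ (c.consBlock 0 (Nat.zero_add k)).embedding (i.succ : Fin (c.length + 1)) =
        Fin.tail α ∘ c.embedding i := by
    intro α i
    funext j
    refine congrArg α (Fin.ext ?_)
    -- The prepended block moves every later starting position by one, which is what `Fin.tail`
    -- undoes.
    change (((0 + 1) :: c.blocks).take (i + 1)).sum + (j : ℕ) = (c.sizeUpTo i + (j : ℕ)) + 1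
    rw [List.take_succ_cons, List.sum_cons, Composition.sizeUpTo]
    omega
  congr 1
  · exact congrArg₂ (X.mat 1) (h0 α) (h0 β)
  · exact Finset.prod_congr rfl fun i _ =>
      congrArg₂ (X.mat (c.blocksFun i)) (h1 α i) (h1 β i)

/-- The compositions with first block `1` contribute exactly `X_1 ⊗ R_k²`, and the others contribute
positive matrices. This lower bound yields both the invertibility of `R_k` and the boundedness of
the shifts. -/
theorem Rsq_succ_sub_posSemidef (k : ℕ) :
    (X.Rsq (k + 1) - tensor (X.mat 1) (X.Rsq k)).PosSemidef := by
  classical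
  have hinj : Function.Injective fun c : Composition k => c.consBlock 0 (Nat.zero_add k) := by
    intro c c' h
    have := congrArg Composition.blocks h
    simp only [Composition.consBlock, List.cons.injEq, true_and] at this
    exact Composition.ext this
  have h1 : tensor (X.mat 1) (X.Rsq k) =
      ∑ c ∈ Finset.univ.image fun c : Composition k => c.consBlock 0 (Nat.zero_add k),
        X.RsqTerm c := by
    rw [Finset.sum_image fun _ _ _ _ h => hinj h]
    simp only [RsqTerm_consBlock]
    ext α β
    simp [Matrix.sum_apply, tensor_apply, Rsq_eq_sum, Finset.mul_sum]
  rw [h1, Rsq_eq_sum, ← Finset.sum_sdiff (Finset.subset_univ (Finset.univ.image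
    fun c : Composition k => c.consBlock 0 (Nat.zero_add k))), add_sub_cancel_right]
  exact Matrix.posSemidef_sum _ fun c _ => X.RsqTerm_posSemidef c

end AdmissibleSeq

/-! ### Positivity of the compressed sums and of the resulting kernels. -/

section

open ContinuousLinearMap

/-- Factoring `x = Y^* Y` turns the double sum into a sum of terms `b b^*`. -/
theorem sum_smul_mul_star_nonneg {A ι : Type*} [Fintype ι] [Ring A] [StarRing A] [PartialOrder A]
    [StarOrderedRing A] [Algebra ℂ A] [StarModule ℂ A] {x : Matrix ι ι ℂ} (hx : x.PosSemidef)
    (a : ι → A) : 0 ≤ ∑ α, ∑ β, x α β • (a α * star (a β)) := by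
  classical
  obtain ⟨Y, rfl⟩ := CStarAlgebra.nonneg_iff_eq_star_mul_self.1 (Matrix.nonneg_iff_posSemidef.2 hx)
  have : ∑ α, ∑ β, (star Y * Y) α β • (a α * star (a β)) =
      ∑ γ, (∑ α, star (Y γ α) • a α) * star (∑ α, star (Y γ α) • a α) := by
    simp only [star_sum, star_smul, star_star, Finset.sum_mul_sum, Matrix.mul_apply,
      Matrix.star_apply, Finset.sum_smul, smul_mul_smul_comm]
    rw [Finset.sum_congr rfl fun α _ => Finset.sum_comm, Finset.sum_comm]
  rw [this]
  exact Finset.sum_nonneg fun γ _ => mul_star_self_nonneg _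

namespace AdmissibleSeq

variable {d : ℕ} (X : AdmissibleSeq d)
variable {H : Type*} [NormedAddCommGroup H] [InnerProductSpace ℂ H] [CompleteSpace H]

/-- `T^{(k)} (X_k ⊗ B) T^{(k)*} = ∑ x_{α,β} T_α B T_β^*`, over words of length `k`. -/
def phiMap (T : Fin d → H →L[ℂ] H) (B : H →L[ℂ] H) (k : ℕ) : H →L[ℂ] H :=
  ∑ α, ∑ β, X.mat k α β • (wordOp T α * B * star (wordOp T β))

theorem phiTerm_eq (T : Fin d → H →L[ℂ] H) (k : ℕ) :
    X.phiTerm T k = ∑ α, ∑ β, X.mat k α β • (wordOp T α * star (wordOp T β)) := rfl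

theorem phiTerm_nonneg (T : Fin d → H →L[ℂ] H) {k : ℕ} (hk : 1 ≤ k) : 0 ≤ X.phiTerm T k :=
  sum_smul_mul_star_nonneg (X.posSemidef k hk) _

/-- The terms are positive, so partial sums lie below the weak limit. Only these finite inequalities
enter the construction of the multiplier. -/
theorem sum_phiTerm_le_one {T : Fin d → H →L[ℂ] H} (hT : X.IsContractiveTuple T) (n : ℕ) :
    ∑ k ∈ Finset.range n, X.phiTerm T (k + 1) ≤ 1 := by
  obtain ⟨Φ, hΦ, hle⟩ := hT
  refine le_trans ?_ hle
  rw [le_def, isPositive_iff_complex]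
  intro f
  have h0 : ∀ k, 0 ≤ ⟪f, X.phiTerm T (k + 1) f⟫_ℂ := fun k =>
    ((nonneg_iff_isPositive _).1 (X.phiTerm_nonneg T (by omega))).inner_nonneg_right f
  have h1 : 0 ≤ ⟪f, (Φ - ∑ k ∈ Finset.range n, X.phiTerm T (k + 1)) f⟫_ℂ := by
    rw [sub_apply, inner_sub_right, sum_apply, inner_sum, sub_nonneg]
    exact sum_le_hasSum _ (fun k _ => h0 k) (hΦ f f)
  rw [← inner_conj_symm]
  have h2 := Complex.le_def.1 h1
  have h3 := Complex.eq_re_of_ofReal_le h1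
  rw [h3]
  simpa using h2.1

omit [CompleteSpace H] in
-- The empty product is set apart because `P * P = P` is not assumed here.
theorem comp_list_prod {T : List (H →L[ℂ] H)} {P : H →L[ℂ] H}
    (h : ∀ A ∈ T, P * A * P = A * P) : P * T.prod * P = T.prod * P ∨ T = [] := by
  induction T with
  | nil => exact Or.inr rfl
  | cons A T ih =>
    left
    have hA := h A (by simp)
    rcases ih fun B hB => h B (by simp [hB]) with h1 | rfl
    · calc P * (A :: T).prod * P = P * A * (T.prod * P) := by
            rw [List.prod_cons]; simp only [mul_assoc]
        _ = (P * A * P) * (T.prod * P) := by rw [mul_assoc (P * A) P, ← mul_assoc P T.prod, h1]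
        _ = A * (P * T.prod * P) := by rw [hA]; simp only [mul_assoc]
        _ = (A :: T).prod * P := by rw [h1, List.prod_cons, mul_assoc]
    · simpa using hA

omit [CompleteSpace H] in
theorem projection_wordOp {T : Fin d → H →L[ℂ] H} {P : H →L[ℂ] H} (hP : P * P = P)
    (h : ∀ i, P * T i * P = T i * P) {k : ℕ} (α : Fin k → Fin d) :
    P * wordOp T α * P = wordOp T α * P := by
  rcases comp_list_prod (T := List.ofFn fun j => T (α j)) (P := P) (by
    intro A hA
    obtain ⟨j, rfl⟩ := (List.mem_ofFn' _ _).1 hA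
    exact h _) with h1 | h1
  · exact h1
  · rw [wordOp, h1]
    simpa using hP

/-- With `Φ_k(B) = ∑ x_{α,β} T_α B T_β^*`, invariance gives `P Φ_k(P) P = Φ_k(P)`. So the difference
splits into `P (I - ∑ Φ_k(I)) P` and `P (∑ Φ_k(I - P)) P`, both positive. -/
theorem sum_phiMap_le {T : Fin d → H →L[ℂ] H} {P : H →L[ℂ] H} (hP : P * P = P) (hPs : star P = P)
    (hT : ∀ i, P * T i * P = T i * P) (n : ℕ)
    (h1 : ∑ k ∈ Finset.range n, X.phiTerm T (k + 1) ≤ 1) :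
    0 ≤ P - ∑ k ∈ Finset.range n, X.phiMap T P (k + 1) := by
  have hw : ∀ {k : ℕ} (α : Fin k → Fin d), P * star (wordOp T α) * P = P * star (wordOp T α) := by
    intro k α
    have := congrArg star (projection_wordOp hP hT α)
    simpa only [star_mul, hPs, mul_assoc] using this
  have hQ : (1 - P) * (1 - P) = 1 - P := by
    rw [mul_sub, sub_mul, sub_mul, hP]; simp
  have hQs : star (1 - P) = 1 - P := by rw [star_sub, star_one, hPs]
  -- This is `Φ_k(I - P)`, with the projection `I - P` written twice so that each summand has the
  -- form `a_α a_β^*`.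
  have h2 : ∀ k, 0 ≤ ∑ α, ∑ β, X.mat (k + 1) α β •
      (wordOp T α * (1 - P) * star (wordOp T β * (1 - P))) := fun k =>
    sum_smul_mul_star_nonneg (X.posSemidef (k + 1) (by omega)) _
  have h3 : ∀ k, P * (∑ α, ∑ β, X.mat (k + 1) α β •
      (wordOp T α * (1 - P) * star (wordOp T β * (1 - P)))) * P =
      P * X.phiTerm T (k + 1) * P - X.phiMap T P (k + 1) := by
    intro k
    simp only [phiTerm_eq, phiMap, Finset.mul_sum, Finset.sum_mul, ← Finset.sum_sub_distrib]
    refine Finset.sum_congr rfl fun α _ => Finset.sum_congr rfl fun β _ => ?_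
    simp only [mul_smul_comm, smul_mul_assoc, ← smul_sub]
    congr 1
    rw [star_mul, hQs]
    have e1 : wordOp T α * (1 - P) * ((1 - P) * star (wordOp T β)) =
        wordOp T α * star (wordOp T β) - wordOp T α * P * star (wordOp T β) := by
      rw [mul_assoc, ← mul_assoc (1 - P), hQ, sub_mul, mul_sub, one_mul, mul_assoc]
    have e2 : P * (wordOp T α * P * star (wordOp T β)) * P = wordOp T α * P * star (wordOp T β) :=
      calc P * (wordOp T α * P * star (wordOp T β)) * P
          = (P * wordOp T α * P) * star (wordOp T β) * P := by simp only [mul_assoc]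
        _ = wordOp T α * (P * star (wordOp T β) * P) := by
          rw [projection_wordOp hP hT]; simp only [mul_assoc]
        _ = _ := by rw [hw]; simp only [mul_assoc]
    rw [e1, mul_sub, sub_mul, e2]
  have h4 : P - ∑ k ∈ Finset.range n, X.phiMap T P (k + 1) =
      P * (1 - ∑ k ∈ Finset.range n, X.phiTerm T (k + 1)) * star P +
      P * (∑ k ∈ Finset.range n, ∑ α, ∑ β, X.mat (k + 1) α β •
      (wordOp T α * (1 - P) * star (wordOp T β * (1 - P)))) * star P := by
    rw [hPs, Finset.mul_sum, Finset.sum_mul, Finset.sum_congr rfl fun k _ => h3 k,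
      Finset.sum_sub_distrib, mul_sub, sub_mul, mul_one, hP, Finset.mul_sum, Finset.sum_mul]
    abel
  rw [h4]
  exact add_nonneg (star_right_conjugate_nonneg (sub_nonneg.2 h1) _)
    (star_right_conjugate_nonneg (Finset.sum_nonneg fun k _ => h2 k) _)

section Eval

variable {G : Type*} [NormedAddCommGroup G] [InnerProductSpace ℂ G]

omit [CompleteSpace H] in
theorem comp_wordOp {T : Fin d → H →L[ℂ] H} {z : Fin d → ℂ} {e : H →L[ℂ] G}
    (h : ∀ i, e ∘L T i = z i • e) {k : ℕ} (α : Fin k → Fin d) :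
    e ∘L wordOp T α = monomial z α • e := by
  induction k with
  | zero => simp [wordOp, monomial]; rfl
  | succ k ih =>
    have h1 : wordOp T α = T (α 0) ∘L wordOp T (fun j => α j.succ) := by
      simp [wordOp, List.ofFn_succ, mul_def]
    have h2 : monomial z α = z (α 0) * monomial z (fun j => α j.succ) := by
      simp [monomial, Fin.prod_univ_succ]
    rw [h1, ← comp_assoc, h, smul_comp, ih, h2, mul_smul]

/-- The evaluation turns `T_α` into `z_α`, and the adjoint of the other one turns `T_β^*` into
`conj(w_β)`; `B` is untouched. -/
theorem comp_phiMap_comp [CompleteSpace G] {T : Fin d → H →L[ℂ] H} {z w : Fin d → ℂ} {e f : H →L[ℂ] G}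
    (he : ∀ i, e ∘L T i = z i • e) (hf : ∀ i, f ∘L T i = w i • f) (B : H →L[ℂ] H) (k : ℕ) :
    e ∘L X.phiMap T B k ∘L adjoint f = form (X.mat k) z w • (e ∘L B ∘L adjoint f) := by
  have key : ∀ α β : Fin k → Fin d, e ∘L (wordOp T α * B * star (wordOp T β)) ∘L adjoint f =
      (monomial z α * starRingEnd ℂ (monomial w β)) • (e ∘L B ∘L adjoint f) := by
    intro α β
    have h2 : star (wordOp T β) ∘L adjoint f =
        starRingEnd ℂ (monomial w β) • adjoint f := by
      rw [star_eq_adjoint, ← adjoint_comp, comp_wordOp hf, map_smulₛₗ]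
    calc e ∘L (wordOp T α * B * star (wordOp T β)) ∘L adjoint f
        = (e ∘L wordOp T α) ∘L B ∘L (star (wordOp T β) ∘L adjoint f) := rfl
      _ = _ := by
        rw [h2, comp_wordOp he, comp_smul, comp_smul, smul_comp, smul_smul, mul_comm]
  ext g
  simp only [coe_comp, Function.comp_apply, phiMap, sum_apply, map_sum, smul_apply, map_smul, form,
    Finset.sum_smul]
  refine Finset.sum_congr rfl fun α _ => Finset.sum_congr rfl fun β _ => ?_
  have := congrArg (fun A => A g) (key α β)
  simp only [coe_comp, Function.comp_apply, smul_apply] at this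
  rw [this, smul_smul]
  ring_nf

end Eval

end AdmissibleSeq

/-- The quadratic form of this kernel is `⟪Q v, v⟫` at `v = ∑ e(x)^* v_x`. -/
theorem posSemidef_comp_adjoint {Ω H G : Type*} [NormedAddCommGroup H] [InnerProductSpace ℂ H]
    [CompleteSpace H] [NormedAddCommGroup G] [InnerProductSpace ℂ G] [CompleteSpace G]
    {Q : H →L[ℂ] H} (hQ : 0 ≤ Q) (e : Ω → H →L[ℂ] G) :
    (Matrix.of fun z w => e z ∘L Q ∘L adjoint (e w)).PosSemidef := by
  have hQ' := (nonneg_iff_isPositive _).1 hQ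
  have key := (RKHS.posSemidef_tfae
    (K := Matrix.of fun z w => e z ∘L Q ∘L adjoint (e w))).out 0 2
  refine key.2 ⟨?_, fun v => ?_⟩
  · ext1 z w
    rw [Matrix.conjTranspose_apply, Matrix.of_apply, Matrix.of_apply, star_eq_adjoint,
      adjoint_comp, adjoint_comp, adjoint_adjoint, hQ'.isSelfAdjoint.adjoint_eq, comp_assoc]
  · have : (v.sum fun x w => v.sum fun x' w' =>
        ⟪(Matrix.of fun z w => e z ∘L Q ∘L adjoint (e w)) x' x w, w'⟫_ℂ) =
        ⟪Q (v.sum fun x w => adjoint (e x) w), v.sum fun x w => adjoint (e x) w⟫_ℂ := by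
      simp only [Finsupp.sum, map_sum, sum_inner, inner_sum, Matrix.of_apply, coe_comp,
        Function.comp_apply, adjoint_inner_right]
      rw [Finset.sum_comm]
    rw [this]
    exact hQ'.re_inner_nonneg_left _

theorem posSemidef_of_tendsto {Ω G : Type*} [NormedAddCommGroup G] [InnerProductSpace ℂ G]
    [CompleteSpace G] {L : ℕ → Matrix Ω Ω (G →L[ℂ] G)} {K : Matrix Ω Ω (G →L[ℂ] G)}
    (hL : ∀ n, (L n).PosSemidef)
    (h : ∀ z w, Filter.Tendsto (fun n => L n z w) Filter.atTop (nhds (K z w))) :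
    K.PosSemidef := by
  have hL' : ∀ n, (L n).IsHermitian ∧ ∀ vv : Ω →₀ G, 0 ≤ RCLike.re (vv.sum fun x w =>
      vv.sum fun x' w' => ⟪L n x' x w, w'⟫_ℂ) := fun n => by
    have key := (RKHS.posSemidef_tfae (K := L n)).out 0 2
    exact key.1 (hL n)
  have key := (RKHS.posSemidef_tfae (K := K)).out 0 2
  refine key.2 ⟨?_, fun v => ?_⟩
  · ext1 z w
    rw [Matrix.conjTranspose_apply]
    refine tendsto_nhds_unique ((continuous_star.tendsto _).comp (h w z)) ?_
    refine (h z w).congr fun n => ?_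
    exact ((hL n).1.apply z w).symm
  · refine ge_of_tendsto' (x := Filter.atTop) (f := fun n => RCLike.re (v.sum fun x w => v.sum fun x' w' =>
      ⟪L n x' x w, w'⟫_ℂ)) ?_ fun n => (hL' n).2 v
    refine (RCLike.continuous_re.tendsto _).comp ?_
    refine tendsto_finsetSum _ fun x _ => tendsto_finsetSum _ fun y _ => ?_
    exact ((((apply ℂ G (v x)).continuous.tendsto _).comp (h y x)).inner tendsto_const_nhds)

end

/-! ### Construction of the partially isometric multiplier, and the converse. -/

section

open ContinuousLinearMap

namespace AdmissibleSeq

variable {d : ℕ} (X : AdmissibleSeq d)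
variable {H₁ H₂ : Type*} [NormedAddCommGroup H₁] [InnerProductSpace ℂ H₁] [CompleteSpace H₁]
  [NormedAddCommGroup H₂] [InnerProductSpace ℂ H₂] [CompleteSpace H₂]

omit [CompleteSpace H₂] in
theorem wordOp_ampliation (M : Fin d → H₂ →L[ℂ] H₂) (G : Type*) [NormedAddCommGroup G]
    [InnerProductSpace ℂ G] {k : ℕ} (α : Fin k → Fin d) :
    wordOp (fun i => HTensor.ampliation (M i) G) α = HTensor.ampliation (wordOp M α) G := by
  rw [wordOp, wordOp, HTensor.ampliation_list_prod, List.map_ofFn]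
  rfl

theorem phiTerm_ampliation (M : Fin d → H₂ →L[ℂ] H₂) (G : Type*) [NormedAddCommGroup G]
    [InnerProductSpace ℂ G] (k : ℕ) :
    X.phiTerm (fun i => HTensor.ampliation (M i) G) k =
      HTensor.ampliation (X.phiTerm M k) G := by
  simp only [phiTerm, HTensor.ampliation_sum, HTensor.ampliation_smul, HTensor.ampliation_comp,
    HTensor.ampliation_adjoint, wordOp_ampliation]

/-- The source `H₁` enters only through its evaluations, whose kernel is `K^R_c`; the target only
through separating evaluations and the partial-sum bounds. Factoring the positive kernel `(1 - s)
ev_z P ev_w^*` through its own reproducing kernel space gives `Θ`. -/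
theorem exists_partialIsometric_multiplier {e₁ : X.domain → H₁ →L[ℂ] ℂ}
    (hk : ∀ z w, e₁ z ((InnerProductSpace.toDual ℂ H₁).symm (e₁ w)) = X.KRFun z w)
    {e₂ : X.domain → H₂ →L[ℂ] ℂ} (he₂ : ∀ x, (∀ z, e₂ z x = 0) → x = 0)
    {M : Fin d → H₂ →L[ℂ] H₂} (hM : ∀ i (z : X.domain), e₂ z ∘L M i = (z : Fin d → ℂ) i • e₂ z)
    (hM1 : ∀ n, ∑ k ∈ Finset.range n, X.phiTerm M (k + 1) ≤ 1)
    {G : Type u} [NormedAddCommGroup G] [InnerProductSpace ℂ G] [CompleteSpace G]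
    {S : Submodule ℂ (HTensor H₂ G)} (hS : IsClosed (S : Set (HTensor H₂ G)))
    (hinv : ∀ i, ∀ f ∈ S, HTensor.ampliation (M i) G f ∈ S) :
    ∃ (D : Type u) (_ : NormedAddCommGroup D) (_ : InnerProductSpace ℂ D)
      (_ : CompleteSpace D) (Θ : X.domain → (D →L[ℂ] G))
      (MΘ : HTensor H₁ D →L[ℂ] HTensor H₂ G),
      IsMultiplicationOp e₁ e₂ Θ MΘ ∧ IsPartialIsometry MΘ ∧
      (S : Set (HTensor H₂ G)) = Set.range MΘ := by
  have : CompleteSpace S := hS.completeSpace_coe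
  set T : Fin d → HTensor H₂ G →L[ℂ] HTensor H₂ G := fun i => HTensor.ampliation (M i) G with hT
  set ev : X.domain → HTensor H₂ G →L[ℂ] G := fun z => HTensor.slice (e₂ z) G with hev
  have hevT : ∀ i (z : X.domain), ev z ∘L T i = (z : Fin d → ℂ) i • ev z := fun i z => by
    rw [hev, hT]
    simp only
    rw [HTensor.slice_ampliation, hM, HTensor.slice_smul]
  set P := S.starProjection with hP
  have hPP : P * P = P := S.isIdempotentElem_starProjection
  have hPs : star P = P := (isSelfAdjoint_starProjection S)
  have hPT : ∀ i, P * T i * P = T i * P := fun i => by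
    ext f
    exact Submodule.starProjection_eq_self_iff.2 (hinv i _ (S.starProjection_apply_mem f))
  have hT1 : ∀ n, ∑ k ∈ Finset.range n, X.phiTerm T (k + 1) ≤ 1 := fun n => by
    rw [hT]
    simp only [phiTerm_ampliation]
    rw [← HTensor.ampliation_sum]
    exact HTensor.ampliation_le_one (hM1 n)
  let L : Matrix X.domain X.domain (G →L[ℂ] G) :=
    Matrix.of fun z w => (1 - X.symbol z w) • (ev z ∘L P ∘L adjoint (ev w))
  have hL : L.PosSemidef := by
    -- `L` is the pointwise limit of the kernels of the positive operators `P - ∑_{k<n} Φ_{k+1}(P)`,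
    -- so no operator series needs to converge.
    refine posSemidef_of_tendsto (fun n => posSemidef_comp_adjoint
      (X.sum_phiMap_le hPP hPs hPT n (hT1 n)) ev) fun z w => ?_
    have h1 : ∀ n, ev z ∘L (P - ∑ k ∈ Finset.range n, X.phiMap T P (k + 1)) ∘L adjoint (ev w) =
        (1 - ∑ k ∈ Finset.range n, form (X.mat (k + 1)) (z : Fin d → ℂ) w) •
          (ev z ∘L P ∘L adjoint (ev w)) := fun n => by
      rw [sub_comp, comp_sub, sub_smul, one_smul, Finset.sum_smul]
      congr 1
      simp only [← X.comp_phiMap_comp (hevT · z) (hevT · w)]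
      ext g
      simp
    simp only [Matrix.of_apply, h1, L]
    exact (tendsto_const_nhds.sub (X.summable_symbol z w).hasSum.tendsto_sum_nat).smul
      tendsto_const_nhds
  have : Fact L.PosSemidef := ⟨hL⟩
  let D := RKHS.OfKernel L
  have hker : ∀ z w g g', ⟪RKHS.kerFun D z g', RKHS.kerFun D w g⟫_ℂ =
      (1 - X.symbol z w) * ⟪adjoint (ev z) g', P (adjoint (ev w) g)⟫_ℂ := by
    intro z w g g'
    rw [RKHS.kerFun_inner, RKHS.kerFun_apply, RKHS.OfKernel.kernel_ofKernel]
    simp only [L, Matrix.of_apply, smul_apply, inner_smul_right, coe_comp, Function.comp_apply,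
      adjoint_inner_left]
  -- `V` is the future `M_Θ^*`, defined by `ev_w^* g ↦ k_w ⊗ Θ(w)^* g`. In its Gram matrix the
  -- factor `K^R_c` cancels `1 - s`, leaving that of `P`.
  obtain ⟨V, hV, hVP⟩ := exists_clm_of_inner_eq
    (fun p : X.domain × G => adjoint (ev p.1) p.2)
    (fun p : X.domain × G => adjoint (HTensor.slice (e₁ p.1) D) (RKHS.kerFun D p.1 p.2)) P
    (by
      intro x hx
      refine HTensor.eq_zero_of_slice_eq_zero he₂ fun z => ext_inner_left ℂ fun g => ?_
      rw [inner_zero_right, ← adjoint_inner_left]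
      exact hx (z, g))
    (by
      rintro ⟨z, g'⟩ ⟨w, g⟩
      simp only
      rw [HTensor.adjoint_slice, HTensor.adjoint_slice, HTensor.inner_incl_tmul, hker,
        InnerProductSpace.toDual_symm_apply, hk, ← mul_assoc, X.KRFun_mul, one_mul])
  obtain ⟨h1, h2⟩ := isPartialIsometry_of_comp_adjoint (P := adjoint V) S (by
    rw [adjoint_adjoint, hVP])
  refine ⟨D, inferInstance, inferInstance, inferInstance, fun z => adjoint (RKHS.kerFun D z),
    adjoint V, fun f z => ext_inner_left ℂ fun g => ?_, h1, h2⟩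
  rw [← adjoint_inner_left, adjoint_inner_right, hV (z, g), adjoint_inner_left,
    adjoint_inner_right]

omit [CompleteSpace H₁] in
-- At `z`, both sides applied to `f` have the value `z_i Θ(z) f(z)`, and the evaluations separate
-- points.
theorem ampliation_comp_multiplicationOp {e₁ : X.domain → H₁ →L[ℂ] ℂ}
    {e₂ : X.domain → H₂ →L[ℂ] ℂ} (he₂ : ∀ x, (∀ z, e₂ z x = 0) → x = 0)
    {N : Fin d → H₁ →L[ℂ] H₁} (hN : ∀ i (z : X.domain), e₁ z ∘L N i = (z : Fin d → ℂ) i • e₁ z)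
    {M : Fin d → H₂ →L[ℂ] H₂} (hM : ∀ i (z : X.domain), e₂ z ∘L M i = (z : Fin d → ℂ) i • e₂ z)
    {D G : Type*} [NormedAddCommGroup D] [InnerProductSpace ℂ D] [CompleteSpace D]
    [NormedAddCommGroup G] [InnerProductSpace ℂ G] [CompleteSpace G]
    {Θ : X.domain → (D →L[ℂ] G)} {MΘ : HTensor H₁ D →L[ℂ] HTensor H₂ G}
    (h : IsMultiplicationOp e₁ e₂ Θ MΘ) (i : Fin d) :
    HTensor.ampliation (M i) G ∘L MΘ = MΘ ∘L HTensor.ampliation (N i) D := by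
  ext f
  rw [← sub_eq_zero]
  refine HTensor.eq_zero_of_slice_eq_zero he₂ fun z => ?_
  have h1 : ∀ f, HTensor.slice (e₂ z) G (HTensor.ampliation (M i) G f) =
      (z : Fin d → ℂ) i • HTensor.slice (e₂ z) G f := fun f => by
    rw [← ContinuousLinearMap.comp_apply, HTensor.slice_ampliation, hM, HTensor.slice_smul, smul_apply]
  have h2 : ∀ f, HTensor.slice (e₁ z) D (HTensor.ampliation (N i) D f) =
      (z : Fin d → ℂ) i • HTensor.slice (e₁ z) D f := fun f => by
    rw [← ContinuousLinearMap.comp_apply, HTensor.slice_ampliation, hN, HTensor.slice_smul, smul_apply]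
  rw [map_sub, ContinuousLinearMap.comp_apply, ContinuousLinearMap.comp_apply, h1, h _ z, h _ z, h2, map_smul, sub_self]

theorem invariant_of_eq_range {H H' : Type*} [NormedAddCommGroup H] [NormedSpace ℂ H]
    [NormedAddCommGroup H'] [NormedSpace ℂ H'] {S : Submodule ℂ H} {A : H →L[ℂ] H}
    {B : H' →L[ℂ] H'} {P : H' →L[ℂ] H} (h : A ∘L P = P ∘L B) (hS : (S : Set H) = Set.range P) :
    ∀ f ∈ S, A f ∈ S := by
  intro f hf
  rw [← SetLike.mem_coe, hS] at hf ⊢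
  obtain ⟨x, rfl⟩ := hf
  exact ⟨B x, (congrArg (fun C => C x) h).symm⟩

end AdmissibleSeq

end

/-! ### Boundedness of the weighted shifts. -/

section Euclidean

open Matrix

variable {n : Type*} [Fintype n] [DecidableEq n]

theorem toEuclideanLin_mul_apply (A B : Matrix n n ℂ) (x : EuclideanSpace ℂ n) :
    toEuclideanLin (A * B) x = toEuclideanLin A (toEuclideanLin B x) := by
  simp [toLpLin_apply, mulVec_mulVec]

theorem inner_toEuclideanLin_left (A : Matrix n n ℂ) (x y : EuclideanSpace ℂ n) :
    ⟪toEuclideanLin A x, y⟫_ℂ = ⟪x, toEuclideanLin Aᴴ y⟫_ℂ := by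
  rw [toEuclideanLin_conjTranspose_eq_adjoint, LinearMap.adjoint_inner_right]

/-- The hypothesis `c Z Z^* ≤ I` bounds `Z^*` by `1 / √c`; the bound passes to `Z` through `‖Zx‖² =
⟪x, Z^* Z x⟫`. -/
theorem norm_toEuclideanLin_le {c : ℝ} (hc : 0 < c) {Z : Matrix n n ℂ}
    (h : (1 - (c : ℂ) • (Z * Zᴴ)).PosSemidef) (x : EuclideanSpace ℂ n) :
    ‖toEuclideanLin Z x‖ ≤ (Real.sqrt c)⁻¹ * ‖x‖ := by
  have h1 : ∀ y, Real.sqrt c * ‖toEuclideanLin Zᴴ y‖ ≤ ‖y‖ := by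
    intro y
    refine le_of_sq_le_sq ?_ (norm_nonneg _)
    have h2 := ((isPositive_toEuclideanLin_iff (A := 1 - (c : ℂ) • (Z * Zᴴ))).2 h).2 y
    rw [map_sub, LinearMap.sub_apply, inner_sub_left, map_smul, LinearMap.smul_apply,
      inner_smul_left, toEuclideanLin_mul_apply, inner_toEuclideanLin_left Z] at h2
    have h3 : toEuclideanLin (1 : Matrix n n ℂ) y = y := by simp
    rw [h3, inner_self_eq_norm_sq_to_K, inner_self_eq_norm_sq_to_K, Complex.conj_ofReal] at h2
    have h4 : (0 : ℝ) ≤ ‖y‖ ^ 2 - c * ‖toEuclideanLin Zᴴ y‖ ^ 2 := by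
      refine le_of_le_of_eq h2 ?_
      simp only [Complex.coe_algebraMap, RCLike.re_to_complex]
      norm_cast
    rw [mul_pow, Real.sq_sqrt hc.le]
    linarith
  have hs := Real.sqrt_pos.2 hc
  rw [← div_eq_inv_mul, le_div_iff₀ hs]
  rcases (norm_nonneg (toEuclideanLin Z x)).eq_or_lt with h0 | h0
  · rw [← h0, zero_mul]; exact norm_nonneg _
  refine le_of_mul_le_mul_right ?_ h0
  calc ‖toEuclideanLin Z x‖ * Real.sqrt c * ‖toEuclideanLin Z x‖
      = Real.sqrt c * RCLike.re ⟪toEuclideanLin Z x, toEuclideanLin Z x⟫_ℂ := by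
        rw [inner_self_eq_norm_sq]; ring
    _ ≤ Real.sqrt c * (‖x‖ * ‖toEuclideanLin Zᴴ (toEuclideanLin Z x)‖) := by
        rw [inner_toEuclideanLin_left]
        gcongr
        exact (RCLike.re_le_norm _).trans (norm_inner_le_norm _ _)
    _ = ‖x‖ * (Real.sqrt c * ‖toEuclideanLin Zᴴ (toEuclideanLin Z x)‖) := by ring
    _ ≤ ‖x‖ * ‖toEuclideanLin Z x‖ := by gcongr; exact h1 _

end Euclidean

/-- The sequence `0, L₀ ξ₀, L₁ ξ₁, …`. -/
def shiftSeq {E : ℕ → Type*} [∀ k, NormedAddCommGroup (E k)] [∀ k, InnerProductSpace ℂ (E k)]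
    (L : ∀ k, E k →ₗ[ℂ] E (k + 1)) (ξ : ∀ k, E k) : ∀ k, E k
  | 0 => 0
  | k + 1 => L k (ξ k)

theorem exists_lp_shift {E : ℕ → Type*} [∀ k, NormedAddCommGroup (E k)]
    [∀ k, InnerProductSpace ℂ (E k)] (L : ∀ k, E k →ₗ[ℂ] E (k + 1)) {C : ℝ} (hC : 0 ≤ C)
    (hL : ∀ k x, ‖L k x‖ ≤ C * ‖x‖) :
    ∃ A : lp E 2 →L[ℂ] lp E 2, ∀ ξ, (A ξ) 0 = 0 ∧ ∀ k, (A ξ) (k + 1) = L k (ξ k) := by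
  have h2 : (0 : ℝ) < (2 : ENNReal).toReal := by norm_num
  have hsum : ∀ ξ : lp E 2, Summable fun k => ‖ξ k‖ ^ 2 := fun ξ => by
    simpa using (memℓp_gen_iff h2).1 (lp.memℓp ξ)
  have hle : ∀ (ξ : lp E 2) k, ‖L k (ξ k)‖ ^ 2 ≤ C ^ 2 * ‖ξ k‖ ^ 2 := fun ξ k => by
    rw [← mul_pow]
    exact pow_le_pow_left₀ (norm_nonneg _) (hL k _) 2
  have hf1 : ∀ ξ : lp E 2, Summable fun k => ‖L k (ξ k)‖ ^ 2 := fun ξ =>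
    ((hsum ξ).mul_left (C ^ 2)).of_nonneg_of_le (fun _ => by positivity) (hle ξ)
  have hf0 : ∀ ξ : lp E 2, Summable fun k => ‖shiftSeq L ξ k‖ ^ 2 := fun ξ =>
    (summable_nat_add_iff (f := fun k => ‖shiftSeq L ξ k‖ ^ 2) 1).1 (hf1 ξ)
  have hf : ∀ ξ : lp E 2, Memℓp (shiftSeq L ξ) 2 := fun ξ => by
    refine memℓp_gen ?_
    simpa using hf0 ξ
  let A : lp E 2 →ₗ[ℂ] lp E 2 :=
    { toFun := fun ξ => ⟨shiftSeq L ξ, hf ξ⟩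
      map_add' := fun ξ η => by
        ext k
        cases k with
        | zero => exact (add_zero (0 : E 0)).symm
        | succ k => exact (L k).map_add (ξ k) (η k)
      map_smul' := fun c ξ => by
        ext k
        cases k with
        | zero => exact (smul_zero c).symm
        | succ k => exact (L k).map_smul c (ξ k) }
  refine ⟨A.mkContinuous C fun ξ => ?_, fun ξ => ⟨rfl, fun k => rfl⟩⟩
  refine le_of_sq_le_sq ?_ (by positivity)
  have hn : ∀ ξ : lp E 2, ‖ξ‖ ^ 2 = ∑' k, ‖ξ k‖ ^ 2 := fun ξ => by
    simpa using lp.norm_rpow_eq_tsum h2 ξ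
  have hA : ‖A ξ‖ ^ 2 = ∑' k, ‖shiftSeq L ξ k‖ ^ 2 := hn (A ξ)
  rw [mul_pow, hA, hn ξ, ← tsum_mul_left, (hf0 ξ).tsum_eq_zero_add]
  have h0 : ‖shiftSeq L ξ 0‖ ^ 2 = 0 := by simp [shiftSeq]
  rw [h0, zero_add]
  exact (hf1 ξ).tsum_le_tsum (hle ξ) ((hsum ξ).mul_left _)

namespace AdmissibleSeq

open Matrix

variable {d : ℕ} (X : AdmissibleSeq d)

theorem Rsq_zero : X.Rsq 0 = 1 := by
  ext α β
  have h := X.form_Rsq_zero 1 1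
  rw [Subsingleton.elim β α, Matrix.one_apply_eq]
  simpa [form, monomial, Subsingleton.elim default α] using h

theorem Rsq_posDef (k : ℕ) : (X.Rsq k).PosDef := by
  induction k with
  | zero => rw [Rsq_zero]; exact PosDef.one
  | succ k ih =>
    have h1 : (tensor (X.mat 1) (X.Rsq k)).PosDef := by
      refine (X.mat_one_posDef.kronecker ih).submatrix fun α β h => ?_
      rw [Prod.mk.injEq] at h
      rw [← Fin.cons_self_tail α, ← Fin.cons_self_tail β, h.2, congrFun h.1 0]
    have := (X.Rsq_succ_sub_posSemidef k)
    rw [← sub_add_cancel (X.Rsq (k + 1)) (tensor (X.mat 1) (X.Rsq k))]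
    exact PosDef.posSemidef_add this h1

theorem R_mul_R (k : ℕ) : X.R k * X.R k = X.Rsq k :=
  CFC.sqrt_mul_sqrt_self _ (X.Rsq_posSemidef k).nonneg

theorem R_conjTranspose (k : ℕ) : (X.R k)ᴴ = X.R k :=
  (Matrix.nonneg_iff_posSemidef.1 (CFC.sqrt_nonneg (X.Rsq k))).1

theorem isUnit_R (k : ℕ) : IsUnit (X.R k) :=
  (CFC.isUnit_sqrt_iff _ (X.Rsq_posSemidef k).nonneg).2 (X.Rsq_posDef k).isUnit

theorem isUnit_det_R (k : ℕ) : IsUnit (X.R k).det :=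
  (Matrix.isUnit_iff_isUnit_det _).1 (X.isUnit_R k)

theorem sum_words_succ {M : Type*} [AddCommMonoid M] {k : ℕ} (f : (Fin (k + 1) → Fin d) → M) :
    ∑ α, f α = ∑ i, ∑ α : Fin k → Fin d, f (Fin.cons i α) := by
  rw [← (Fin.consEquiv fun _ : Fin (k + 1) => Fin d).sum_comp, Fintype.sum_prod_type]
  rfl

theorem idTensor_eq_tensor {k : ℕ} (A : Matrix (Fin k → Fin d) (Fin k → Fin d) ℂ) :
    idTensor A = tensor 1 A := by
  ext α β
  rw [tensor_apply, Matrix.one_apply]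
  by_cases h : α 0 = β 0
  · simp [idTensor, h]
  · have : (fun _ : Fin 1 => α 0) ≠ fun _ => β 0 := fun h' => h (congrFun h' 0)
    simp [idTensor, h, this]

theorem idTensor_mul {k : ℕ} (A B : Matrix (Fin k → Fin d) (Fin k → Fin d) ℂ) :
    idTensor A * idTensor B = idTensor (A * B) := by
  ext α β
  rw [Matrix.mul_apply, sum_words_succ]
  simp only [idTensor, Matrix.of_apply, Fin.cons_zero, Fin.tail_cons, Matrix.mul_apply]
  rw [Finset.sum_eq_single (α 0) (fun i _ hi => by simp [Ne.symm hi]) (by simp)]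
  by_cases h : α 0 = β 0 <;> simp [h]

theorem idTensor_conjTranspose {k : ℕ} (A : Matrix (Fin k → Fin d) (Fin k → Fin d) ℂ) :
    (idTensor A)ᴴ = idTensor Aᴴ := by
  ext α β
  by_cases h : α 0 = β 0
  · simp [idTensor, Matrix.conjTranspose_apply, h]
  · simp [idTensor, Matrix.conjTranspose_apply, h, Ne.symm h]

/-- The linear map `θ ↦ e_i ⊗ θ`. -/
def tensorLeftₗ (i : Fin d) (k : ℕ) :
    EuclideanSpace ℂ (Fin k → Fin d) →ₗ[ℂ] EuclideanSpace ℂ (Fin (k + 1) → Fin d) where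
  toFun := tensorLeft i
  map_add' x y := by
    ext α
    by_cases h : α 0 = i <;> simp [tensorLeft, h]
  map_smul' c x := by
    ext α
    by_cases h : α 0 = i <;> simp [tensorLeft, h]

theorem inner_tensorLeft (i : Fin d) {k : ℕ} (v : EuclideanSpace ℂ (Fin (k + 1) → Fin d))
    (θ : EuclideanSpace ℂ (Fin k → Fin d)) :
    ⟪v, tensorLeft i θ⟫_ℂ = ∑ α, θ α * starRingEnd ℂ (v (Fin.cons i α)) := by
  rw [PiLp.inner_apply, sum_words_succ]
  rw [Finset.sum_eq_single i (fun j _ hj => by simp [tensorLeft, hj]) (by simp)]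
  simp [tensorLeft]

theorem norm_tensorLeft (i : Fin d) {k : ℕ} (θ : EuclideanSpace ℂ (Fin k → Fin d)) :
    ‖tensorLeft i θ‖ = ‖θ‖ := by
  rw [← sq_eq_sq₀ (norm_nonneg _) (norm_nonneg _), EuclideanSpace.norm_sq_eq,
    EuclideanSpace.norm_sq_eq, sum_words_succ,
    Finset.sum_eq_single i (fun j _ hj => by simp [tensorLeft, hj]) (by simp)]
  simp [tensorLeft]

theorem idTensor_tensorLeft (i : Fin d) {k : ℕ} (A : Matrix (Fin k → Fin d) (Fin k → Fin d) ℂ)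
    (θ : EuclideanSpace ℂ (Fin k → Fin d)) :
    toEuclideanLin (idTensor A) (tensorLeft i θ) = tensorLeft i (toEuclideanLin A θ) := by
  ext α
  simp only [toLpLin_apply, tensorLeft, mulVec, dotProduct]
  rw [sum_words_succ, Finset.sum_eq_single i (fun j _ hj => by simp [hj]) (by simp)]
  by_cases h : α 0 = i <;> simp [idTensor, h]

theorem R_mul_Z (k : ℕ) : X.R (k + 1) * X.Z (k + 1) = idTensor (X.R k) := by
  rw [Z, ← mul_assoc, Matrix.mul_nonsing_inv _ (X.isUnit_det_R _), one_mul]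

theorem exists_sub_smul_posSemidef : ∃ c : ℝ, 0 < c ∧ (X.mat 1 - (c : ℂ) • 1).PosSemidef := by
  cases isEmpty_or_nonempty (Fin 1 → Fin d) with
  -- For `d = 0` the matrices are empty and any `c` works; otherwise the spectrum of `X_1` is
  -- bounded below by a positive number.
  | inl h => exact ⟨1, one_pos, by rw [Subsingleton.elim (X.mat 1 - _) 0]; exact .zero⟩
  | inr h =>
    have hp := X.mat_one_posDef
    obtain ⟨c, hc, hle⟩ := (CFC.exists_pos_algebraMap_le_iff (a := X.mat 1) hp.1).2
      fun x hx => (Matrix.isStrictlyPositive_iff_posDef.2 hp).spectrum_pos hx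
    refine ⟨c, hc, ?_⟩
    rw [Matrix.le_iff, Algebra.algebraMap_eq_smul_one] at hle
    simpa using hle

/-- From `R_{k+1}² ≥ X_1 ⊗ R_k² ≥ c (I ⊗ R_k²)`, conjugation by `R_{k+1}⁻¹` gives `c Z Z^* ≤ I`,
with `c` independent of `k`. -/
theorem exists_norm_Z_le : ∃ C : ℝ, 0 ≤ C ∧ ∀ k (x : EuclideanSpace ℂ (Fin (k + 1) → Fin d)),
    ‖toEuclideanLin (X.Z (k + 1)) x‖ ≤ C * ‖x‖ := by
  obtain ⟨c, hc, hX⟩ := X.exists_sub_smul_posSemidef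
  refine ⟨(Real.sqrt c)⁻¹, by positivity, fun k => norm_toEuclideanLin_le hc ?_⟩
  set Q := (X.R (k + 1))⁻¹
  have hQ : Qᴴ = Q := by rw [Matrix.conjTranspose_nonsing_inv, R_conjTranspose]
  have h1 : (X.Rsq (k + 1) - (c : ℂ) • idTensor (X.Rsq k)).PosSemidef := by
    have h2 : X.Rsq (k + 1) - (c : ℂ) • idTensor (X.Rsq k) =
        (X.Rsq (k + 1) - tensor (X.mat 1) (X.Rsq k)) +
          tensor (X.mat 1 - (c : ℂ) • 1) (X.Rsq k) := by
      ext α β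
      simp only [idTensor_eq_tensor, Matrix.sub_apply, Matrix.add_apply, Matrix.smul_apply,
        tensor_apply, smul_eq_mul]
      ring
    rw [h2]
    exact (X.Rsq_succ_sub_posSemidef k).add (tensor_posSemidef hX (X.Rsq_posSemidef k))
  have h3 : 1 - (c : ℂ) • (X.Z (k + 1) * (X.Z (k + 1))ᴴ) =
      Q * (X.Rsq (k + 1) - (c : ℂ) • idTensor (X.Rsq k)) * Qᴴ := by
    have e1 : Q * X.Rsq (k + 1) * Q = 1 := by
      rw [← R_mul_R, ← mul_assoc, Matrix.nonsing_inv_mul _ (X.isUnit_det_R _), one_mul,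
        Matrix.mul_nonsing_inv _ (X.isUnit_det_R _)]
    have e2 : X.Z (k + 1) * (X.Z (k + 1))ᴴ = Q * idTensor (X.Rsq k) * Q := by
      rw [Z, Matrix.conjTranspose_mul, idTensor_conjTranspose, R_conjTranspose, hQ, ← R_mul_R,
        ← idTensor_mul]
      simp only [mul_assoc, Q]
    rw [hQ, mul_sub, sub_mul, e1, e2, mul_smul_comm, smul_mul_assoc]
  rw [h3]
  exact h1.mul_mul_conjTranspose_same _

theorem exists_isWeightedShift (i : Fin d) : ∃ A : Fock d →L[ℂ] Fock d, X.IsWeightedShift i A := by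
  obtain ⟨C, hC, hZ⟩ := X.exists_norm_Z_le
  have hL : ∀ k x, ‖(toEuclideanLin (X.Z (k + 1)) ∘ₗ tensorLeftₗ i k) x‖ ≤ C * ‖x‖ := fun k x => by
    rw [← norm_tensorLeft i x]
    exact hZ k (tensorLeft i x)
  obtain ⟨A, hA⟩ := exists_lp_shift
    (E := fun k => EuclideanSpace ℂ (Fin k → Fin d))
    (fun k => toEuclideanLin (X.Z (k + 1)) ∘ₗ tensorLeftₗ i k) hC hL
  exact ⟨A, fun ξ => ⟨(hA ξ).1, fun k => (hA ξ).2 k⟩⟩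

end AdmissibleSeq

/-- A vector orthogonal to all monomials is orthogonal to all symmetric tensors. -/
theorem sum_symm_mul_eq_zero {d k : ℕ} {v : (Fin k → Fin d) → ℂ}
    (h : ∀ w : Fin d → ℂ, ∑ α, (∏ j, w (α j)) * v α = 0) {s : (Fin k → Fin d) → ℂ}
    (hs : ∀ (σ : Equiv.Perm (Fin k)) (α : Fin k → Fin d), s (α ∘ σ) = s α) :
    ∑ α, s α * v α = 0 := by
  classical
  -- The letter counts of a word determine it up to permutation, so symmetric tensors depend only on
  -- them.
  let ty : (Fin k → Fin d) → (Fin d →₀ ℕ) := fun α => ∑ j, Finsupp.single (α j) 1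
  have hty : ∀ α i, ty α i = Fintype.card {j // α j = i} := by
    intro α i
    rw [Fintype.card_subtype, Finset.card_filter]
    simp [ty, Finsupp.finsetSum_apply, Finsupp.single_apply]
  have hperm : ∀ α β, ty α = ty β → s α = s β := by
    intro α β hαβ
    let e : Fin k ≃ Fin k := Equiv.ofFiberEquiv (f := β) (g := α) fun i =>
      Fintype.equivOfCardEq (by rw [← hty, ← hty, hαβ])
    have : α ∘ e = β := by
      funext j
      exact Equiv.ofFiberEquiv_map _ j
    rw [← this, hs]
  -- The pairings with monomials are the values of `p`, so `p = 0`. Its coefficients are the sums of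
  -- `v` over words with given letter counts.
  let p : MvPolynomial (Fin d) ℂ := ∑ α, MvPolynomial.monomial (ty α) (v α)
  have hp : p = 0 := by
    refine MvPolynomial.funext fun w => ?_
    rw [map_zero, ← h w, map_sum]
    refine Finset.sum_congr rfl fun α _ => ?_
    have : MvPolynomial.monomial (ty α) (v α) =
        MvPolynomial.C (v α) * ∏ j, MvPolynomial.X (α j) := by
      rw [← mul_one (v α), ← MvPolynomial.C_mul_monomial, MvPolynomial.monomial_sum_one, mul_one]
      rfl
    rw [this]
    simp [mul_comm]
  have hc : ∀ m, ∑ α with ty α = m, v α = 0 := by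
    intro m
    have := congrArg (MvPolynomial.coeff m) hp
    simpa [p, MvPolynomial.coeff_sum, MvPolynomial.coeff_monomial, Finset.sum_filter] using this
  rw [← Finset.sum_fiberwise_of_maps_to (t := Finset.univ.image ty) (g := ty)
    fun α _ => Finset.mem_image_of_mem _ (Finset.mem_univ α)]
  refine Finset.sum_eq_zero fun m hm => ?_
  obtain ⟨β, -, rfl⟩ := Finset.mem_image.1 hm
  rw [Finset.sum_congr rfl fun α hα => by rw [hperm α β (Finset.mem_filter.1 hα).2],
    ← Finset.mul_sum, hc, mul_zero]

theorem eq_zero_of_eventually_hasSum {p : ℕ → ℂ}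
    (h : ∀ᶠ t in nhds (0 : ℂ), HasSum (fun k => t ^ k * p k) 0) (k : ℕ) : p k = 0 := by
  have h1 : HasFPowerSeriesAt (0 : ℂ → ℂ) (FormalMultilinearSeries.ofScalars ℂ p) 0 := by
    rw [hasFPowerSeriesAt_iff]
    simpa [FormalMultilinearSeries.coeff_ofScalars] using h
  have h2 := congrArg (fun q => FormalMultilinearSeries.coeff q k) h1.eq_zero
  rw [FormalMultilinearSeries.coeff_ofScalars] at h2
  exact h2.trans (by simp [FormalMultilinearSeries.coeff])

/-! ### The domain near the origin, and the identification of `E_{K^R_c}` with `F(R)`. -/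

namespace AdmissibleSeq

open Matrix

variable {d : ℕ} (X : AdmissibleSeq d)

theorem form_eq_inner {k : ℕ} (A : Matrix (Fin k → Fin d) (Fin k → Fin d) ℂ) (z w : Fin d → ℂ) :
    form A z w = ⟪powStar z k, toEuclideanLin A (powStar w k)⟫_ℂ := by
  simp only [form, PiLp.inner_apply, powStar, toLpLin_apply, mulVec, dotProduct,
    RCLike.inner_apply, Complex.conj_conj, Finset.sum_mul]
  refine Finset.sum_congr rfl fun α _ => Finset.sum_congr rfl fun β _ => ?_
  ring

theorem norm_powStar_sq (w : Fin d → ℂ) (k : ℕ) :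
    ‖powStar w k‖ ^ 2 = (∑ i, ‖w i‖ ^ 2) ^ k := by
  rw [EuclideanSpace.norm_sq_eq, Fintype.sum_pow]
  refine Finset.sum_congr rfl fun α _ => ?_
  simp [powStar, monomial, norm_prod, Finset.prod_pow]

theorem monomial_smul (t : ℂ) (w : Fin d → ℂ) {k : ℕ} (α : Fin k → Fin d) :
    monomial (t • w) α = t ^ k * monomial w α := by
  simp [monomial, Finset.prod_mul_distrib]

theorem exists_norm_mat_le : ∃ C : ℝ, 0 ≤ C ∧ ∀ᶠ k in Filter.atTop,
    ‖toEuclideanCLM (n := Fin k → Fin d) (𝕜 := ℂ) (X.mat k)‖ ≤ C ^ k := by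
  obtain ⟨C, hC1, hC2⟩ := ENNReal.lt_iff_exists_nnreal_btwn.1 X.limsup_lt_top
  refine ⟨C, C.2, ?_⟩
  filter_upwards [Filter.eventually_lt_of_limsup_lt hC1, Filter.eventually_gt_atTop 0] with k hk hk0
  rw [one_div] at hk
  have h1 := (ENNReal.rpow_inv_le_iff (by exact_mod_cast hk0)).1 hk.le
  rw [ENNReal.rpow_natCast, ← ENNReal.coe_pow, enorm_le_coe] at h1
  exact_mod_cast h1

theorem norm_form_le {k : ℕ} (A : Matrix (Fin k → Fin d) (Fin k → Fin d) ℂ) (w : Fin d → ℂ) :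
    ‖form A w w‖ ≤ ‖toEuclideanCLM (n := Fin k → Fin d) (𝕜 := ℂ) A‖ * (∑ i, ‖w i‖ ^ 2) ^ k := by
  rw [form_eq_inner, ← norm_powStar_sq]
  calc _ ≤ ‖powStar w k‖ * ‖toEuclideanCLM (n := Fin k → Fin d) (𝕜 := ℂ) A (powStar w k)‖ :=
        norm_inner_le_norm _ _
    _ ≤ ‖powStar w k‖ * (‖toEuclideanCLM (n := Fin k → Fin d) (𝕜 := ℂ) A‖ * ‖powStar w k‖) := by
        gcongr
        exact ContinuousLinearMap.le_opNorm _ _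
    _ = _ := by ring

/-- The limsup condition bounds `‖X_k‖` geometrically, so the defining series converges for small
`t` and its sum tends to `0` with `t`. -/
theorem eventually_smul_mem_domain (w : Fin d → ℂ) :
    ∀ᶠ t in nhds (0 : ℂ), t • w ∈ X.domain := by
  obtain ⟨C, hC, hX⟩ := X.exists_norm_mat_le
  set ρ := ∑ i, ‖w i‖ ^ 2 with hρ
  have hρ0 : 0 ≤ ρ := Finset.sum_nonneg fun i _ => by positivity
  -- Chosen so that `C r ρ ≤ 1/2`, which makes the series `b` converge.
  set r : ℝ := (2 * (C * ρ + 1))⁻¹ with hr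
  have hr0 : 0 < r := by positivity
  have hCr : C * (r * ρ) ≤ 1 / 2 := by
    rw [hr, ← mul_assoc, mul_comm C, mul_assoc, inv_mul_le_iff₀ (by positivity)]
    linarith
  set b : ℕ → ℝ := fun k =>
    ‖toEuclideanCLM (n := Fin k → Fin d) (𝕜 := ℂ) (X.mat k)‖ * (r * ρ) ^ k with hb
  have hb0 : ∀ k, 0 ≤ b k := fun k => by positivity
  have hbs : Summable b := by
    refine (summable_geometric_of_lt_one (r := 1 / 2) (by norm_num) (by norm_num)
      ).of_norm_bounded_eventually_nat ?_
    filter_upwards [hX] with k hk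
    rw [Real.norm_of_nonneg (hb0 k)]
    calc b k ≤ C ^ k * (r * ρ) ^ k := by simp only [hb]; gcongr
      _ = (C * (r * ρ)) ^ k := (mul_pow _ _ _).symm
      _ ≤ (1 / 2) ^ k := by gcongr
  have hbs1 : Summable fun k => b (k + 1) := (summable_nat_add_iff 1).2 hbs
  set B := ∑' k, b (k + 1)
  have hB : 0 ≤ B := tsum_nonneg fun k => hb0 _
  -- Every term has degree at least one, so shrinking `‖t‖²` from `r` to `δ r` gains a factor `δ`,
  -- and `δ B < 1`.
  set δ := (1 + B)⁻¹ with hδ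
  have hδ0 : 0 < δ := by positivity
  have hδ1 : δ ≤ 1 := inv_le_one_of_one_le₀ (by linarith)
  have hδB : δ * B < 1 := by
    rw [hδ, inv_mul_lt_iff₀ (by positivity)]
    linarith
  have hev : ∀ᶠ t in nhds (0 : ℂ), ‖t‖ ^ 2 < δ * r := by
    have : Filter.Tendsto (fun t : ℂ => ‖t‖ ^ 2) (nhds 0) (nhds (‖(0 : ℂ)‖ ^ 2)) :=
      (continuous_norm.pow 2).tendsto 0
    refine this.eventually_lt_const ?_
    simpa using mul_pos hδ0 hr0
  filter_upwards [hev] with t ht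
  have hle : ∀ k, ‖form (X.mat (k + 1)) (t • w) (t • w)‖ ≤ δ * b (k + 1) := by
    intro k
    refine (norm_form_le _ _).trans ?_
    have e1 : ∑ i, ‖(t • w) i‖ ^ 2 = ‖t‖ ^ 2 * ρ := by
      simp [hρ, mul_pow, Finset.mul_sum]
    rw [e1]
    have e2 : (‖t‖ ^ 2 * ρ) ^ (k + 1) ≤ δ * (r * ρ) ^ (k + 1) :=
      calc (‖t‖ ^ 2 * ρ) ^ (k + 1) ≤ (δ * r * ρ) ^ (k + 1) := by gcongr
        _ = δ ^ k * (δ * (r * ρ) ^ (k + 1)) := by ring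
        _ ≤ 1 * (δ * (r * ρ) ^ (k + 1)) := by
          gcongr
          exact pow_le_one₀ hδ0.le hδ1
        _ = _ := one_mul _
    calc _ ≤ ‖toEuclideanCLM (n := Fin (k + 1) → Fin d) (𝕜 := ℂ) (X.mat (k + 1))‖ *
          (δ * (r * ρ) ^ (k + 1)) := by gcongr
      _ = _ := by simp only [hb]; ring
  have hs : Summable fun k => ‖form (X.mat (k + 1)) (t • w) (t • w)‖ :=
    (hbs1.mul_left δ).of_nonneg_of_le (fun _ => norm_nonneg _) hle
  refine ⟨∑' k, ‖form (X.mat (k + 1)) (t • w) (t • w)‖, ?_, ?_⟩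
  · refine (hs.tsum_le_tsum hle (hbs1.mul_left δ)).trans_lt ?_
    rwa [tsum_mul_left]
  · have hpos : ∀ k, form (X.mat (k + 1)) (t • w) (t • w) =
        ((‖form (X.mat (k + 1)) (t • w) (t • w)‖ : ℝ) : ℂ) := fun k => by
      have h := (form_posSemidef (X.posSemidef (k + 1) (by omega))
        fun u : Fin d → ℂ => u).diag_nonneg (i := t • w)
      exact (Complex.norm_of_nonneg' h).symm
    have := Complex.hasSum_ofReal.2 hs.hasSum
    exact this.congr_fun hpos

/-! ### The vectors `⊕_k R_k w^{(k)*}` -/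

theorem powStar_mem_symPower (w : Fin d → ℂ) (k : ℕ) : powStar w k ∈ symPower d k := by
  intro σ α
  simp only [powStar, monomial, Function.comp_apply]
  rw [Equiv.prod_comp σ fun j => w (α j)]

theorem inner_R_powStar (z w : Fin d → ℂ) (k : ℕ) :
    ⟪toEuclideanLin (X.R k) (powStar z k), toEuclideanLin (X.R k) (powStar w k)⟫_ℂ =
      form (X.Rsq k) z w := by
  rw [inner_toEuclideanLin_left, R_conjTranspose, ← toEuclideanLin_mul_apply, R_mul_R,
    form_eq_inner]

theorem memℓp_R_powStar (w : X.domain) :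
    Memℓp (fun k => toEuclideanLin (X.R k) (powStar (w : Fin d → ℂ) k)) 2 := by
  refine memℓp_gen ?_
  have h : ∀ k, ‖toEuclideanLin (X.R k) (powStar (w : Fin d → ℂ) k)‖ ^ 2 =
      (form (X.Rsq k) (w : Fin d → ℂ) w).re := fun k => by
    rw [← inner_R_powStar, ← inner_self_eq_norm_sq (𝕜 := ℂ)]
    rfl
  simpa [h] using Complex.hasSum_re (X.summable_KR w w).hasSum |>.summable

/-- The vector `⊕_k R_k w^{(k)*}` of `F(R)`. -/
def kernelVec (w : X.domain) : X.FR :=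
  ⟨⟨fun k => toEuclideanLin (X.R k) (powStar (w : Fin d → ℂ) k), X.memℓp_R_powStar w⟩,
    fun k => ⟨_, powStar_mem_symPower (w : Fin d → ℂ) k, rfl⟩⟩

theorem kernelVec_apply (w : X.domain) (k : ℕ) : (X.kernelVec w : Fock d) k =
    toEuclideanLin (X.R k) (powStar (w : Fin d → ℂ) k) := rfl

theorem hasSum_inner_kernelVec (w : X.domain) (ξ : Fock d) :
    HasSum (fun k => ⟪powStar (w : Fin d → ℂ) k, toEuclideanLin (X.R k) (ξ k)⟫_ℂ)
      ⟪(X.kernelVec w : Fock d), ξ⟫_ℂ := by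
  have := lp.hasSum_inner (𝕜 := ℂ) (X.kernelVec w : Fock d) ξ
  simpa only [kernelVec_apply, inner_toEuclideanLin_left, R_conjTranspose] using this

theorem inner_kernelVec_kernelVec (z w : X.domain) :
    ⟪X.kernelVec z, X.kernelVec w⟫_ℂ = X.KRFun z w := by
  have h := X.hasSum_inner_kernelVec z (X.kernelVec w : Fock d)
  simp only [kernelVec_apply, ← toEuclideanLin_mul_apply, R_mul_R, ← form_eq_inner] at h
  exact h.tsum_eq.symm

theorem inner_powStar {k : ℕ} (w : Fin d → ℂ) (v : EuclideanSpace ℂ (Fin k → Fin d)) :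
    ⟪powStar w k, v⟫_ℂ = ∑ α, monomial w α * v α := by
  simp [powStar, PiLp.inner_apply, mul_comm]

/-- Scaling `w` by small `t` separates degrees in the power series, so `R_k ξ_k` is orthogonal to
every `w^{(k)*}`, hence to all symmetric tensors. -/
theorem eq_zero_of_inner_kernelVec {ξ : X.FR} (h : ∀ w, ⟪X.kernelVec w, ξ⟫_ℂ = 0) : ξ = 0 := by
  have h1 : ∀ (w : Fin d → ℂ) k, ⟪powStar w k, toEuclideanLin (X.R k) ((ξ : Fock d) k)⟫_ℂ = 0 := by
    intro w
    refine eq_zero_of_eventually_hasSum ?_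
    filter_upwards [X.eventually_smul_mem_domain w] with t ht
    have h2 := X.hasSum_inner_kernelVec ⟨t • w, ht⟩ ξ
    rw [show ⟪(X.kernelVec ⟨t • w, ht⟩ : Fock d), (ξ : Fock d)⟫_ℂ = 0 from h _] at h2
    refine h2.congr_fun fun k => ?_
    simp only [inner_powStar, monomial_smul, Finset.mul_sum, mul_assoc]
  refine Subtype.ext (lp.ext (funext fun k => ?_))
  obtain ⟨s, hs, hsξ⟩ := ξ.2 k
  have h2 : ⟪s, toEuclideanLin (X.R k) ((ξ : Fock d) k)⟫_ℂ = 0 := by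
    have := sum_symm_mul_eq_zero (s := fun α => starRingEnd ℂ (s α))
      (v := toEuclideanLin (X.R k) ((ξ : Fock d) k))
      (fun w => (inner_powStar w _).symm.trans (h1 w k)) (fun σ α => by rw [hs σ α])
    rw [PiLp.inner_apply, ← this]
    exact Finset.sum_congr rfl fun α _ => mul_comm _ _
  -- As `ξ_k = R_k s` with `s` symmetric, `‖ξ_k‖² = ⟪s, R_k ξ_k⟫ = 0`.
  have h3 : ⟪(ξ : Fock d) k, (ξ : Fock d) k⟫_ℂ = 0 := by
    conv_lhs => lhs; rw [← hsξ]
    rw [inner_toEuclideanLin_left, R_conjTranspose, h2]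
  exact inner_self_eq_zero.1 h3

/-- The kernel functions and the vectors `⊕ R_k w^{(k)*}` are total families with the same Gram
matrix. -/
theorem exists_unitary : ∃ u : X.KR.Space ≃ₗᵢ[ℂ] X.FR, ∀ w, u (X.KR.kernelFun w) = X.kernelVec w := by
  obtain ⟨V, hV, hV1⟩ := exists_clm_of_inner_eq X.KR.kernelFun X.kernelVec 1
    (fun x hx => RKHS.ext fun z => by
      rw [← PDKernel.inner_kernelFun, hx, RKHS.coe_zero, Pi.zero_apply])
    (fun z w => by
      rw [inner_kernelVec_kernelVec, one_apply_eq_self, PDKernel.inner_kernelFun,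
        PDKernel.kernelFun_apply]
      rfl)
  have hV2 : ∀ x, ContinuousLinearMap.adjoint V (V x) = x := fun x => congrArg (fun A => A x) hV1
  have hinj : ∀ y, ContinuousLinearMap.adjoint V y = 0 → y = 0 := fun y hy =>
    X.eq_zero_of_inner_kernelVec fun w => by
      rw [← hV, ← ContinuousLinearMap.adjoint_inner_right, hy, inner_zero_right]
  let U : X.KR.Space →ₗᵢ[ℂ] X.FR := (V : X.KR.Space →ₗ[ℂ] X.FR).isometryOfInner fun x y => by
    change ⟪V x, V y⟫_ℂ = _
    rw [← ContinuousLinearMap.adjoint_inner_right, hV2]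
  refine ⟨LinearIsometryEquiv.ofSurjective U fun y => ⟨ContinuousLinearMap.adjoint V y, ?_⟩, hV⟩
  change V (ContinuousLinearMap.adjoint V y) = y
  rw [← sub_eq_zero]
  refine hinj _ ?_
  rw [map_sub, hV2, sub_self]

/-- Since `R_{k+1} Z_{k+1} = I ⊗ R_k`, pairing degree `k + 1` with `w^{(k+1)*}` pulls out `w_i` from
the first tensor factor. -/
theorem inner_kernelVec_shift {i : Fin d} {A : Fock d →L[ℂ] Fock d} (hA : X.IsWeightedShift i A)
    (w : X.domain) (ξ : Fock d) :
    ⟪(X.kernelVec w : Fock d), A ξ⟫_ℂ =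
      (w : Fin d → ℂ) i * ⟪(X.kernelVec w : Fock d), ξ⟫_ℂ := by
  have h1 := (X.hasSum_inner_kernelVec w (A ξ))
  have h2 := (X.hasSum_inner_kernelVec w ξ).mul_left ((w : Fin d → ℂ) i)
  have h3 := (hasSum_nat_add_iff' 1).2 h1
  rw [Finset.sum_range_one, (hA ξ).1, map_zero, inner_zero_right, sub_zero] at h3
  refine h3.unique (h2.congr_fun fun k => ?_)
  rw [(hA ξ).2, ← toEuclideanLin_mul_apply, R_mul_Z, idTensor_tensorLeft, inner_tensorLeft,
    inner_powStar, Finset.mul_sum]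
  refine Finset.sum_congr rfl fun α _ => ?_
  simp [powStar, monomial, Fin.prod_univ_succ]
  ring

end AdmissibleSeq

/-! ### Contractivity of the coordinate multiplications on a space with kernel `K^R_c`. -/

section

open ContinuousLinearMap

theorem nonneg_of_posSemidef {E ι : Type*} [NormedAddCommGroup E] [InnerProductSpace ℂ E]
    [CompleteSpace E] {a : ι → E} (ha : ∀ x : E, (∀ i, ⟪a i, x⟫_ℂ = 0) → x = 0) {Q : E →L[ℂ] E}
    (hQ : (Matrix.of fun i j => ⟪a i, Q (a j)⟫_ℂ).PosSemidef) : 0 ≤ Q := by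
  have h1 : ∀ x, 0 ≤ ⟪x, Q x⟫_ℂ := by
    intro x
    refine (denseRange_linearCombination ha).induction_on (p := fun x => 0 ≤ ⟪x, Q x⟫_ℂ) x
      (isClosed_Ici.preimage (continuous_id.inner (𝕜 := ℂ) Q.continuous)) fun c => ?_
    refine le_of_le_of_eq (hQ.2 c) ?_
    simp only [Finsupp.linearCombination_apply, Finsupp.sum, map_sum, sum_inner, inner_sum,
      map_smul, inner_smul_left, inner_smul_right, Matrix.of_apply, Complex.star_def,
      Finset.mul_sum]
    rw [Finset.sum_comm]
    refine Finset.sum_congr rfl fun i _ => Finset.sum_congr rfl fun j _ => by ring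
  rw [nonneg_iff_isPositive, isPositive_iff_complex]
  intro x
  have h2 := Complex.le_def.1 (h1 x)
  rw [← inner_conj_symm, Complex.eq_re_of_ofReal_le (h1 x)]
  simpa using h2.1

namespace AdmissibleSeq

variable {d : ℕ} (X : AdmissibleSeq d)

/-- With `s_n` the partial sum, `K^R_c (1 - s) = 1` gives `(1 - s_n) K^R_c = 1 + (s - s_n) K^R_c`.
The tail is positive by the Schur product theorem. -/
theorem truncated_posSemidef (n : ℕ) : (Matrix.of fun z w : X.domain =>
    (1 - ∑ k ∈ Finset.range n, form (X.mat (k + 1)) (z : Fin d → ℂ) w) *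
      X.KRFun z w).PosSemidef := by
  -- Index `0` carries the constant kernel `1`; index `k + 1` carries the tail term with
  -- `X_{k+n+1}`.
  let F : ℕ → Matrix X.domain X.domain ℂ := fun k => Nat.casesOn k
    (Matrix.of fun _ _ => 1) fun k => (Matrix.of fun z w : X.domain =>
      form (X.mat (k + n + 1)) (z : Fin d → ℂ) w).hadamard (Matrix.of X.KRFun)
  refine posSemidef_of_hasSum (M := F) (fun k => ?_) fun z w => ?_
  · cases k with
    | zero =>
      change (Matrix.of fun _ _ => 1).PosSemidef
      simpa using posSemidef_prod ∅ (fun (_ : ℕ) (_ _ : X.domain) => 0) (by simp)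
    | succ k =>
      exact (form_posSemidef (X.posSemidef (k + n + 1) (by omega))
        fun u : X.domain => (u : Fin d → ℂ)).hadamard X.KR_posSemidef
  · refine (hasSum_nat_add_iff' (f := fun k => F k z w) 1).1 ?_
    have h1 := ((hasSum_nat_add_iff' n).2 (X.summable_symbol z w).hasSum).mul_right (X.KRFun z w)
    have h2 := X.KRFun_mul z w
    have h3 : (∑' k, form (X.mat (k + 1)) (z : Fin d → ℂ) w -
        ∑ k ∈ Finset.range n, form (X.mat (k + 1)) (z : Fin d → ℂ) w) * X.KRFun z w =
        (1 - ∑ k ∈ Finset.range n, form (X.mat (k + 1)) (z : Fin d → ℂ) w) * X.KRFun z w -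
          ∑ k ∈ Finset.range 1, F k z w := by
      rw [symbol] at h2
      rw [Finset.sum_range_one, show F 0 z w = 1 from rfl]
      linear_combination -h2
    rw [h3] at h1
    exact h1

/-- Between kernel functions, `I - ∑_{k<n} Φ_{k+1}(I)` has the matrix `(1 - s_n) K^R_c`, and kernel
functions are total. -/
theorem sum_phiTerm_le_one_of_kernel {H : Type*} [NormedAddCommGroup H] [InnerProductSpace ℂ H]
    [CompleteSpace H] {e : X.domain → H →L[ℂ] ℂ}
    (hk : ∀ z w, e z ((InnerProductSpace.toDual ℂ H).symm (e w)) = X.KRFun z w)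
    (he : ∀ x, (∀ z, e z x = 0) → x = 0)
    {M : Fin d → H →L[ℂ] H} (hM : ∀ i (z : X.domain), e z ∘L M i = (z : Fin d → ℂ) i • e z)
    (n : ℕ) : ∑ k ∈ Finset.range n, X.phiTerm M (k + 1) ≤ 1 := by
  rw [← sub_nonneg]
  refine nonneg_of_posSemidef (a := fun z => (InnerProductSpace.toDual ℂ H).symm (e z))
    (fun x hx => he x fun z => by rw [← InnerProductSpace.toDual_symm_apply, hx]) ?_
  refine (congrArg Matrix.PosSemidef ?_).mpr (X.truncated_posSemidef n)
  ext z w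
  rw [Matrix.of_apply, Matrix.of_apply]
  have hadj : (InnerProductSpace.toDual ℂ H).symm (e w) = adjoint (e w) 1 := by
    refine ext_inner_right ℂ fun x => ?_
    rw [InnerProductSpace.toDual_symm_apply, adjoint_inner_left]
    simp
  have h1 : ∀ k, e z (X.phiTerm M k (adjoint (e w) 1)) =
      form (X.mat k) (z : Fin d → ℂ) w * X.KRFun z w := fun k => by
    have h2 := congrArg (fun A => A 1) (X.comp_phiMap_comp (hM · z) (hM · w) 1 k)
    rw [← hk, hadj]
    simpa [phiMap, phiTerm_eq] using h2
  rw [InnerProductSpace.toDual_symm_apply, sub_apply, map_sub, sum_apply, map_sum, hadj]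
  simp only [h1]
  rw [one_apply_eq_self, ← hadj, hk, sub_mul, one_mul, Finset.sum_mul]

end AdmissibleSeq

end

end

/-! ### The theorem. -/

theorem theorem5p8 {d : ℕ} (hd : 0 < d) (X : AdmissibleSeq d) :
    -- the weighted shifts `A i` are bounded; `W i` is their compression to `F(R)`
    ∃ A : Fin d → (AdmissibleSeq.Fock d →L[ℂ] AdmissibleSeq.Fock d), (∀ i, X.IsWeightedShift i (A i)) ∧
    ∃ W : Fin d → (X.FR →L[ℂ] X.FR), (∀ i, W i = compression X.FR (A i)) ∧
    -- the identification `u` of `E_{K^R_c}` with `F(R)`, under which `M_{z_i}` becomes `W i`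
    ∃ u : X.KR.Space ≃ₗᵢ[ℂ] X.FR,
      (∀ (w : X.domain) (k : ℕ), (u (X.KR.kernelFun w) : AdmissibleSeq.Fock d) k =
        Matrix.toEuclideanLin (X.R k) (AdmissibleSeq.powStar w k)) ∧
      (∀ (i : Fin d) (ξ : X.FR) (z : X.domain),
        u.symm (W i ξ) z = (z : Fin d → ℂ) i * u.symm ξ z) ∧
    ∀ (G : Type u) [NormedAddCommGroup G] [InnerProductSpace ℂ G] [CompleteSpace G],
      (∀ (K : PDKernel X.domain) (M : Fin d → (K.Space →L[ℂ] K.Space)),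
        (∀ (i : Fin d) (f : K.Space) (z : X.domain), M i f z = (z : Fin d → ℂ) i * f z) →
        X.IsContractiveTuple M →
        ∀ S : Submodule ℂ (HTensor K.Space G), IsClosed (S : Set (HTensor K.Space G)) →
          -- (1)
          ((∀ i, ∀ f ∈ S, HTensor.ampliation (M i) G f ∈ S) ↔
            ∃ (D : Type u) (_ : NormedAddCommGroup D) (_ : InnerProductSpace ℂ D)
              (_ : CompleteSpace D) (P : HTensor X.FR D →L[ℂ] HTensor K.Space G),
              IsPartialIsometry P ∧
              (∀ i, HTensor.ampliation (M i) G ∘L P = P ∘L HTensor.ampliation (W i) D) ∧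
              (S : Set (HTensor K.Space G)) = Set.range P) ∧
          -- (2)
          ((∀ i, ∀ f ∈ S, HTensor.ampliation (M i) G f ∈ S) ↔
            ∃ (D : Type u) (_ : NormedAddCommGroup D) (_ : InnerProductSpace ℂ D)
              (_ : CompleteSpace D) (Θ : X.domain → (D →L[ℂ] G))
              (MΘ : HTensor X.KR.Space D →L[ℂ] HTensor K.Space G),
              IsMultiplicationOp X.KR.eval K.eval Θ MΘ ∧ IsPartialIsometry MΘ ∧
              (S : Set (HTensor K.Space G)) = Set.range MΘ)) ∧
      -- (3)
      (∀ S : Submodule ℂ (HTensor X.FR G), IsClosed (S : Set (HTensor X.FR G)) →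
        ((∀ i, ∀ f ∈ S, HTensor.ampliation (W i) G f ∈ S) ↔
          ∃ (D : Type u) (_ : NormedAddCommGroup D) (_ : InnerProductSpace ℂ D)
            (_ : CompleteSpace D) (Θ : X.domain → (D →L[ℂ] G))
            (MΘ : HTensor X.FR D →L[ℂ] HTensor X.FR G),
            IsMultiplicationOp (fun z => X.KR.eval z ∘L (u.symm : X.FR →L[ℂ] X.KR.Space))
              (fun z => X.KR.eval z ∘L (u.symm : X.FR →L[ℂ] X.KR.Space)) Θ MΘ ∧
            IsPartialIsometry MΘ ∧ (S : Set (HTensor X.FR G)) = Set.range MΘ)) := by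
  choose A hA using fun i => X.exists_isWeightedShift i
  obtain ⟨u, hu⟩ := X.exists_unitary
  set W : Fin d → (X.FR →L[ℂ] X.FR) := fun i => compression X.FR (A i) with hW
  have hsymm : ∀ (ξ : X.FR) (z : X.domain), u.symm ξ z = ⟪X.kernelVec z, ξ⟫_ℂ := fun ξ z => by
    rw [← PDKernel.inner_kernelFun, ← hu, ← u.inner_map_map, u.apply_symm_apply]
  have hWz : ∀ (i : Fin d) (ξ : X.FR) (z : X.domain),
      u.symm (W i ξ) z = (z : Fin d → ℂ) i * u.symm ξ z := fun i ξ z => by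
    rw [hsymm, hsymm]
    -- The kernel vector lies in `F(R)`, so the projection in the compression disappears from the
    -- inner product.
    have h := Submodule.inner_orthogonalProjectionOnto_eq_of_mem_left (X.kernelVec z)
      (A i (ξ : AdmissibleSeq.Fock d))
    exact h.trans (X.inner_kernelVec_shift (hA i) z ξ)
  refine ⟨A, hA, W, fun i => rfl, u, fun w k => by rw [hu]; rfl, hWz, fun G _ _ _ => ?_⟩
  set e : X.domain → X.FR →L[ℂ] ℂ :=
    fun z => X.KR.eval z ∘L (u.symm : X.FR →L[ℂ] X.KR.Space) with he
  have hev : ∀ (K : PDKernel X.domain) (x : K.Space), (∀ z, K.eval z x = 0) → x = 0 :=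
    fun K x hx => RKHS.ext fun z => by
      rw [RKHS.coe_zero, Pi.zero_apply]; exact hx z
  have hes : ∀ x, (∀ z, e z x = 0) → x = 0 := fun x hx => by
    have := hev X.KR (u.symm x) hx
    simpa using this
  have heW : ∀ i (z : X.domain), e z ∘L W i = (z : Fin d → ℂ) i • e z := fun i z => by
    ext ξ
    exact hWz i ξ z
  have hek : ∀ z w, e z ((InnerProductSpace.toDual ℂ X.FR).symm (e w)) = X.KRFun z w := by
    intro z w
    have h1 : (InnerProductSpace.toDual ℂ X.FR).symm (e w) = X.kernelVec w := by
      refine ext_inner_right ℂ fun ξ => ?_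
      rw [InnerProductSpace.toDual_symm_apply, ← hsymm]
      rfl
    rw [h1, ← X.inner_kernelVec_kernelVec, ← hsymm]
    rfl
  have hKRk : ∀ z w, X.KR.eval z ((InnerProductSpace.toDual ℂ X.KR.Space).symm (X.KR.eval w)) =
      X.KRFun z w := by
    intro z w
    have h1 : (InnerProductSpace.toDual ℂ X.KR.Space).symm (X.KR.eval w) = X.KR.kernelFun w := by
      refine ext_inner_right ℂ fun f => ?_
      rw [InnerProductSpace.toDual_symm_apply, PDKernel.inner_kernelFun]
      rfl
    rw [h1]
    exact X.KR.kernelFun_apply w z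
  have hW1 := X.sum_phiTerm_le_one_of_kernel hek hes heW
  -- Multiplication by `z_i` on `E_{K^R_c}`; its boundedness is inherited from `W_i` through `u`.
  let N : Fin d → X.KR.Space →L[ℂ] X.KR.Space := fun i =>
    (u.symm : X.FR →L[ℂ] X.KR.Space) ∘L W i ∘L (u : X.KR.Space →L[ℂ] X.FR)
  have hN : ∀ i (z : X.domain), X.KR.eval z ∘L N i = (z : Fin d → ℂ) i • X.KR.eval z :=
    fun i z => by
      ext f
      have := hWz i (u f) z
      rwa [u.symm_apply_apply] at this
  refine ⟨fun K M hM hcontr S hS => ?_, fun S hS => ⟨fun hinv => ?_, ?_⟩⟩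
  · have hKM : ∀ i (z : X.domain), K.eval z ∘L M i = (z : Fin d → ℂ) i • K.eval z := fun i z => by
      ext f
      exact hM i f z
    have hM1 := X.sum_phiTerm_le_one hcontr
    refine ⟨⟨fun hinv => ?_, ?_⟩, ⟨fun hinv => ?_, ?_⟩⟩
    -- For (1) the source is `F(R)` with transported evaluations; the intertwining relation holds
    -- because `P` is a multiplication operator.
    · obtain ⟨D, _, _, _, Θ, P, h1, h2, h3⟩ :=
        X.exists_partialIsometric_multiplier hek (hev K) hKM hM1 hS hinv
      exact ⟨D, _, _, ‹_›, P, h2, X.ampliation_comp_multiplicationOp (hev K) heW hKM h1, h3⟩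
    · rintro ⟨D, _, _, _, P, -, h2, h3⟩ i
      exact AdmissibleSeq.invariant_of_eq_range (h2 i) h3
    · exact X.exists_partialIsometric_multiplier hKRk (hev K) hKM hM1 hS hinv
    · rintro ⟨D, _, _, _, Θ, P, h1, -, h3⟩ i
      exact AdmissibleSeq.invariant_of_eq_range
        (X.ampliation_comp_multiplicationOp (hev K) hN hKM h1 i) h3
  · exact X.exists_partialIsometric_multiplier hek hes heW hW1 hS hinv
  · rintro ⟨D, _, _, _, Θ, P, h1, -, h3⟩ i
    exact AdmissibleSeq.invariant_of_eq_range
      (X.ampliation_comp_multiplicationOp hes heW heW h1 i) h3
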